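/- For points $p_1,\dots,p_n$ in the plane and $2 \le k \le n$, let $\mathrm{OPT}_k(p_1,\dots,p_n)$ denote the maximum, over all selections of $k$ of the $n$ points, of the minimum pairwise Euclidean distance among the selected points ($k$-dispersion). There is a deterministic algorithm on the real RAM (unit-cost arithmetic, comparisons, square root and floor on real numbers; integer words of absolute value $O(n)$; integer program constants only), and there are constants $C$ and $N$, such that the following holds for all integers $n \ge N$ and $k$ with $$3 \cdot 10^5 \le k \le \frac{n}{10^5 \ln n}.$$ On every input of $n$ points in $[0,1]^2$ the algorithm halts after at most $Cn$ steps. If the $n$ input points are chosen independently and uniformly at random in $[0,1]^2$, then with probability at least $1-1/n$ the algorithm outputs $k$ distinct input points whose minimum pairwise distance is at least $0.99 \cdot \mathrm{OPT}_k$. -/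

import Mathlib

open MeasureTheory

/-! ## A real random access machine with unit-cost operations

The machine has integer words and real numbers, kept in separate registers and memories. One step is
one arithmetic operation on a fixed number of registers, one memory access, one output of a word, or
one comparison. Programs are finite objects whose only constants are integers. Every integer that is
written is required to have absolute value at most the word bound `W`; an instruction that would
violate this, divides by zero, or takes the square root of a negative number makes the machine fault,
and a run that faults does not halt. -/

namespace RealRAM

/-- A configuration: integer registers, real registers, integer memory, real memory, and the words
output so far. -/
structure State where
  ireg : ℕ → ℤ
  rreg : ℕ → ℝ
  imem : ℤ → ℤ
  rmem : ℤ → ℝ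
  out : List ℤ

/-- Binary operations on integers. -/
inductive IntOp where
  | add
  | sub
  | mul

/-- Binary operations on reals. -/
inductive RealOp where
  | add
  | sub
  | mul
  | div

/-- Elementary instructions. The natural numbers are names of registers; `d` is the destination. -/
inductive Instr where
  /-- `ireg d := c` -/
  | iconst (d : ℕ) (c : ℤ)
  /-- `ireg d := ireg a op ireg b` -/
  | iop (op : IntOp) (d a b : ℕ)
  /-- `rreg d := ireg a` -/
  | toReal (d a : ℕ)
  /-- `rreg d := rreg a op rreg b` -/
  | rop (op : RealOp) (d a b : ℕ)
  /-- `rreg d := √(rreg a)` -/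
  | rsqrt (d a : ℕ)
  /-- `ireg d := ⌊rreg a⌋` -/
  | floor (d a : ℕ)
  /-- `ireg d := imem (ireg a)` -/
  | iload (d a : ℕ)
  /-- `imem (ireg a) := ireg b` -/
  | istore (a b : ℕ)
  /-- `rreg d := rmem (ireg a)` -/
  | rload (d a : ℕ)
  /-- `rmem (ireg a) := rreg b` -/
  | rstore (a b : ℕ)
  /-- append the word `ireg a` to the output -/
  | emit (a : ℕ)

/-- Tests: comparison of two integer registers or of two real registers. -/
inductive Test where
  /-- `ireg a < ireg b` -/
  | ilt (a b : ℕ)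
  /-- `rreg a < rreg b` -/
  | rlt (a b : ℕ)

/-- Programs, with structured control flow. -/
inductive Prog where
  | nop
  | instr (i : Instr)
  | seq (p q : Prog)
  /-- if `t` then `p` else `q` -/
  | branch (t : Test) (p q : Prog)
  /-- while `t` do `p` -/
  | loop (t : Test) (p : Prog)

def IntOp.eval : IntOp → ℤ → ℤ → ℤ
  | .add, a, b => a + b
  | .sub, a, b => a - b
  | .mul, a, b => a * b

/-- The value of a real operation; `none` for a division by zero. -/
noncomputable def RealOp.eval : RealOp → ℝ → ℝ → Option ℝ
  | .add, a, b => some (a + b)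
  | .sub, a, b => some (a - b)
  | .mul, a, b => some (a * b)
  | .div, a, b => if b = 0 then none else some (a / b)

/-- Write an integer to a register; a fault if it exceeds the word bound. -/
def State.setInt (W : ℕ) (s : State) (d : ℕ) (v : ℤ) : Option State :=
  if |v| ≤ (W : ℤ) then some { s with ireg := Function.update s.ireg d v } else none

def State.setReal (s : State) (d : ℕ) (v : ℝ) : State :=
  { s with rreg := Function.update s.rreg d v }

/-- The effect of an instruction on a configuration; `none` is a fault. -/
noncomputable def Instr.step (W : ℕ) (s : State) : Instr → Option State
  | .iconst d c => s.setInt W d c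
  | .iop op d a b => s.setInt W d (op.eval (s.ireg a) (s.ireg b))
  | .toReal d a => some (s.setReal d (s.ireg a : ℝ))
  | .rop op d a b => (op.eval (s.rreg a) (s.rreg b)).map (s.setReal d)
  | .rsqrt d a => if s.rreg a < 0 then none else some (s.setReal d (Real.sqrt (s.rreg a)))
  | .floor d a => s.setInt W d ⌊s.rreg a⌋
  | .iload d a => s.setInt W d (s.imem (s.ireg a))
  | .istore a b => some { s with imem := Function.update s.imem (s.ireg a) (s.ireg b) }
  | .rload d a => some (s.setReal d (s.rmem (s.ireg a)))
  | .rstore a b => some { s with rmem := Function.update s.rmem (s.ireg a) (s.rreg b) }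
  | .emit a => some { s with out := s.out ++ [s.ireg a] }

def Test.Holds (s : State) : Test → Prop
  | .ilt a b => s.ireg a < s.ireg b
  | .rlt a b => s.rreg a < s.rreg b

/-- `Exec W p s t s'`: with word bound `W`, the program `p` started in the configuration `s` halts
without a fault after exactly `t` steps, in the configuration `s'`. -/
inductive Exec (W : ℕ) : Prog → State → ℕ → State → Prop
  | nop (s : State) : Exec W .nop s 1 s
  | instr {i : Instr} {s s' : State} (h : i.step W s = some s') : Exec W (.instr i) s 1 s'
  | seq {p q : Prog} {s₀ s₁ s₂ : State} {t₁ t₂ : ℕ}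
      (hp : Exec W p s₀ t₁ s₁) (hq : Exec W q s₁ t₂ s₂) : Exec W (.seq p q) s₀ (t₁ + t₂) s₂
  | branch_true {c : Test} {p q : Prog} {s s' : State} {t : ℕ}
      (hc : c.Holds s) (hp : Exec W p s t s') : Exec W (.branch c p q) s (1 + t) s'
  | branch_false {c : Test} {p q : Prog} {s s' : State} {t : ℕ}
      (hc : ¬ c.Holds s) (hq : Exec W q s t s') : Exec W (.branch c p q) s (1 + t) s'
  | loop_true {c : Test} {p : Prog} {s₀ s₁ s₂ : State} {t₁ t₂ : ℕ}
      (hc : c.Holds s₀) (hp : Exec W p s₀ t₁ s₁) (hl : Exec W (.loop c p) s₁ t₂ s₂) :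
      Exec W (.loop c p) s₀ (1 + t₁ + t₂) s₂
  | loop_false {c : Test} {p : Prog} {s : State}
      (hc : ¬ c.Holds s) : Exec W (.loop c p) s 1 s

/-- The machine is deterministic: the running time and the final configuration are determined by the
program and the initial configuration. -/
theorem Exec.deterministic {W : ℕ} {p : Prog} {s s₁ : State} {t₁ : ℕ} (h₁ : Exec W p s t₁ s₁) :
    ∀ {t₂ : ℕ} {s₂ : State}, Exec W p s t₂ s₂ → t₁ = t₂ ∧ s₁ = s₂ := by
  induction h₁ with
  | nop s => intro t₂ s₂ h; cases h; exact ⟨rfl, rfl⟩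
  | instr h =>
    intro t₂ s₂ h'
    cases h' with
    | instr h' => exact ⟨rfl, Option.some.inj (h.symm.trans h')⟩
  | seq _ _ ihp ihq =>
    intro t₂ s₂ h
    cases h with
    | seq hp hq =>
      obtain ⟨rfl, rfl⟩ := ihp hp
      obtain ⟨rfl, rfl⟩ := ihq hq
      exact ⟨rfl, rfl⟩
  | branch_true hc _ ih =>
    intro t₂ s₂ h
    cases h with
    | branch_true _ hp => obtain ⟨rfl, rfl⟩ := ih hp; exact ⟨rfl, rfl⟩
    | branch_false hc' _ => exact absurd hc hc'
  | branch_false hc _ ih =>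
    intro t₂ s₂ h
    cases h with
    | branch_true hc' _ => exact absurd hc' hc
    | branch_false _ hq => obtain ⟨rfl, rfl⟩ := ih hq; exact ⟨rfl, rfl⟩
  | loop_true hc _ _ ihp ihl =>
    intro t₂ s₂ h
    cases h with
    | loop_true _ hp hl =>
      obtain ⟨rfl, rfl⟩ := ihp hp
      obtain ⟨rfl, rfl⟩ := ihl hl
      exact ⟨rfl, rfl⟩
    | loop_false hc' => exact absurd hc hc'
  | loop_false hc =>
    intro t₂ s₂ h
    cases h with
    | loop_true hc' _ _ => exact absurd hc' hc
    | loop_false _ => exact ⟨rfl, rfl⟩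

end RealRAM

/-! ## Dispersion of points in the plane -/

namespace Dispersion

/-- The Euclidean plane. -/
abbrev Plane : Type := EuclideanSpace ℝ (Fin 2)

/-- The unit square `[0,1]²`. -/
def unitSquare : Set Plane := {x | ∀ j, x j ∈ Set.Icc (0 : ℝ) 1}

/-- The law of `n` independent random points, each uniformly distributed in the unit square. -/
noncomputable def uniformPoints (n : ℕ) : Measure (Fin n → Plane) :=
  Measure.pi fun _ => ProbabilityTheory.cond volume unitSquare

/-- The minimum distance between two of the points `p i`, `i ∈ K` (meant for `K` with at least two
elements). -/
noncomputable def minDist {n : ℕ} (p : Fin n → Plane) (K : Finset (Fin n)) : ℝ :=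
  sInf {d | ∃ i ∈ K, ∃ j ∈ K, i ≠ j ∧ d = dist (p i) (p j)}

/-- The optimum of `k`-dispersion: the maximum over all selections of `k` of the `n` points of their
minimum distance (meant for `2 ≤ k ≤ n`). -/
noncomputable def opt {n : ℕ} (p : Fin n → Plane) (k : ℕ) : ℝ :=
  sSup {d | ∃ K : Finset (Fin n), K.card = k ∧ d = minDist p K}

/-- The list of words `out` consists of the indices, without repetition, of `k` of the given points
whose minimum distance is at least `c` times the optimum. -/
def IsApprox (c : ℝ) {n : ℕ} (p : Fin n → Plane) (k : ℕ) (out : List ℤ) : Prop :=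
  ∃ l : List (Fin n), out = l.map (fun i => ((i : ℕ) : ℤ)) ∧ l.Nodup ∧ l.length = k ∧
    c * opt p k ≤ minDist p l.toFinset

/-- The initial configuration: `n` and `k` are in the integer registers `0` and `1`, the coordinates
of the `i`-th point are in the cells `2i` and `2i+1` of the real memory, and all else is zero. -/
noncomputable def input {n : ℕ} (k : ℕ) (p : Fin n → Plane) : RealRAM.State where
  ireg := fun a => if a = 0 then (n : ℤ) else if a = 1 then (k : ℤ) else 0
  rreg := fun _ => 0
  imem := fun _ => 0
  rmem := fun a =>
    if h : 0 ≤ a ∧ a < 2 * n then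
      p ⟨(a / 2).toNat, by omega⟩ (if a % 2 = 0 then 0 else 1)
    else 0
  out := []

/-- On the input `n`, `k`, `p`, the program halts after at most `T` steps with output `out`, all
integers being of absolute value at most `W`. -/
def OutputsWithin (prog : RealRAM.Prog) (W T : ℕ) {n : ℕ} (k : ℕ) (p : Fin n → Plane)
    (out : List ℤ) : Prop :=
  ∃ (t : ℕ) (s : RealRAM.State), t ≤ T ∧ RealRAM.Exec W prog (input k p) t s ∧ s.out = out

end Dispersion

/-! ### Area of truncated Voronoi cells and Thue's packing bound. -/

namespace Dispersion

/-! Enlarge the unit square by the factor L = `scale k`, about 0.9317 √k, and lay over it a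
hexagonal lattice of spacing 1, stretched very slightly in the vertical direction, with a tiny
square cell of side 1/230 at each lattice point. The algorithm scans the input once and keeps the
first point it meets in each cell, until k points are kept. Rounding finds the cell of a point, and
a mark stored under a cell number of size O(k) tells whether the cell is used up, so the running
time is linear on every input in the square.

Kept points lie in different cells, hence at scaled distance at least 1 - 123/20000
(`sq_dist_ge_of_cell_ne`). On the other side, Thue's theorem bounds every selection of k points in
the square: the Voronoi cells, truncated to discs, are disjoint and each has at least the area of a
regular hexagon (`volume_truncatedVoronoi_ge`, `card_mul_le_of_separated`). So the scaled optimum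
exceeds 1 only slightly, and for k ≥ 3 · 10⁵ the boundary terms are small enough for the ratio 0.99
(`scaled_opt_le`).

It remains to see that k points are found. At least k whole cells fit into the square
(`exists_cells`), and each has area above 2 · 10⁻⁵ / k. By the upper bound on k, a given cell is
missed with probability at most n⁻², and a union bound over k ≤ n cells gives 1/n
(`uniformPoints_hit_cells_ge`). If k cells are hit, the selection is full (`IsSelection.length_eq`).
-/

open Set Real in
/-- A set that contains, in each direction `θ`, the open segment of length `R θ` from the origin, has
area at least `∫ R² / 2`. -/
lemma ofReal_integral_le_volume_of_radial {S : Set (ℝ × ℝ)} (hS : MeasurableSet S) {g R : ℝ → ℝ}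
    (hg : IntegrableOn g (Ioo (-π) π)) (h0 : ∀ θ, 0 ≤ g θ) (hR : ∀ θ, 0 ≤ R θ)
    (hgR : ∀ θ, g θ ≤ R θ ^ 2 / 2)
    (hin : ∀ θ r, 0 < r → r < R θ → (r * cos θ, r * sin θ) ∈ S) :
    ENNReal.ofReal (∫ θ in Ioo (-π) π, g θ) ≤ volume S := by
  rw [← lintegral_indicator_one hS, ← lintegral_comp_polarCoord_symm,
    ofReal_integral_eq_lintegral_ofReal hg (Filter.Eventually.of_forall h0)]
  have hm : Measurable fun p : ℝ × ℝ =>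
      ENNReal.ofReal p.1 • S.indicator (1 : ℝ × ℝ → ENNReal) (polarCoord.symm p) :=
    (ENNReal.measurable_ofReal.comp measurable_fst).smul
      ((measurable_one.indicator hS).comp continuous_polarCoord_symm.measurable)
  rw [polarCoord_target, Measure.volume_eq_prod, setLIntegral_prod_symm _ hm.aemeasurable]
  refine lintegral_mono fun θ => ?_
  have h1 : ENNReal.ofReal (R θ ^ 2 / 2) = ∫⁻ r in Ioo 0 (R θ), ENNReal.ofReal r := by
    have : R θ ^ 2 / 2 = ∫ r in Ioo 0 (R θ), r := by
      rw [← integral_Ioc_eq_integral_Ioo, ← intervalIntegral.integral_of_le (hR θ)]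
      simp
    rw [this, ofReal_integral_eq_lintegral_ofReal]
    · exact (continuous_id.integrableOn_Icc (a := 0) (b := R θ)).mono_set Ioo_subset_Icc_self
    · filter_upwards [ae_restrict_mem measurableSet_Ioo] with r hr using hr.1.le
  calc ENNReal.ofReal (g θ) ≤ ENNReal.ofReal (R θ ^ 2 / 2) := ENNReal.ofReal_le_ofReal (hgR θ)
    _ = ∫⁻ r in Ioo 0 (R θ), ENNReal.ofReal r := h1
    _ ≤ ∫⁻ r in Ioo 0 (R θ),
          ENNReal.ofReal r • S.indicator (1 : ℝ × ℝ → ENNReal) (polarCoord.symm (r, θ)) := by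
        refine setLIntegral_mono' measurableSet_Ioo fun r hr => ?_
        have : polarCoord.symm (r, θ) ∈ S := hin θ r hr.1 hr.2
        rw [indicator_of_mem this]; simp
    _ ≤ _ := lintegral_mono_set Ioo_subset_Ioi_self

/-- For a line at distance `h` from the centre of a disc of radius `ρ`, in the direction at an angle
of cosine `t` with its normal: the amount by which half the squared length of the segment up to the
line exceeds `c`, and `0` for directions in which the line is not met inside the disc. -/
noncomputable def sectorExcess (ρ c h t : ℝ) : ℝ := if h < ρ * t then h ^ 2 / (2 * t ^ 2) - c else 0

lemma measurable_sectorExcess (ρ c h : ℝ) : Measurable (sectorExcess ρ c h) := by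
  unfold sectorExcess
  refine Measurable.ite (measurableSet_lt measurable_const (by fun_prop)) ?_ measurable_const
  fun_prop

lemma abs_sectorExcess_le {ρ c h : ℝ} (hρ : 0 < ρ) (hc : 0 ≤ c) (hh : 0 < h) (t : ℝ) :
    |sectorExcess ρ c h t| ≤ ρ ^ 2 / 2 + c := by
  unfold sectorExcess
  split_ifs with ht
  · have ht0 : 0 < t := by
      by_contra h'
      nlinarith
    have : h ^ 2 / (2 * t ^ 2) ≤ ρ ^ 2 / 2 := by
      rw [div_le_div_iff₀ (by positivity) (by norm_num)]
      nlinarith [mul_self_le_mul_self hh.le ht.le]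
    have : 0 ≤ h ^ 2 / (2 * t ^ 2) := by positivity
    rw [abs_le]; constructor <;> nlinarith [sq_nonneg ρ]
  · rw [abs_zero]; positivity

lemma integrableOn_sectorExcess {ρ c h : ℝ} (hρ : 0 < ρ) (hc : 0 ≤ c) (hh : 0 < h) (φ : ℝ)
    {s : Set ℝ} (hs : volume s ≠ ⊤) :
    IntegrableOn (fun θ => sectorExcess ρ c h (Real.cos (θ - φ))) s := by
  refine Measure.integrableOn_of_bounded hs ?_ (M := ρ ^ 2 / 2 + c) ?_
  · exact ((measurable_sectorExcess ρ c h).comp (by fun_prop)).aestronglyMeasurable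
  · exact Filter.Eventually.of_forall fun θ => abs_sectorExcess_le hρ hc hh _

-- By concavity, the sine lies above its chord from 0 to π/3.
open Real in
lemma mul_le_sin_of_le_pi_div_three {x : ℝ} (h0 : 0 ≤ x) (h1 : x ≤ π / 3) :
    3 * √3 / (2 * π) * x ≤ sin x := by
  have hc : (1 - x / (π / 3)) • sin 0 + (x / (π / 3)) • sin (π / 3) ≤
      sin ((1 - x / (π / 3)) • 0 + (x / (π / 3)) • (π / 3)) :=
    strictConcaveOn_sin_Icc.concaveOn.2 ⟨le_rfl, pi_pos.le⟩
      ⟨by positivity, by linarith [pi_pos]⟩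
      (by rw [sub_nonneg, div_le_one (by positivity)]; exact h1) (by positivity) (by ring)
  simp only [smul_eq_mul, mul_zero, sin_zero, zero_add, sin_pi_div_three] at hc
  rw [div_mul_cancel₀ _ (by positivity : π / 3 ≠ 0)] at hc
  calc 3 * √3 / (2 * π) * x = x / (π / 3) * (√3 / 2) := by field_simp
    _ ≤ sin x := hc

-- The constant subtracted is the mean over all directions of half the squared radius of the
-- inscribed regular hexagon. The line is met within half-angle α ≤ π/6 of its normal, so the
-- integral is ρ²/2 · sin 2α minus a multiple of α that vanishes at α = π/6, the hexagon's own side.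
-- Concavity of the sine does the rest.
open Real Set in
lemma integral_sectorExcess_nonneg {ρ h : ℝ} (hρ : 0 < ρ) (hh : 0 < h) (h3 : 3 * ρ ^ 2 ≤ 4 * h ^ 2)
    (φ : ℝ) :
    0 ≤ ∫ θ in Ioo (-π) π, sectorExcess ρ (ρ ^ 2 * (3 * √3) / (4 * π)) h (cos (θ - φ)) := by
  set c := ρ ^ 2 * (3 * √3) / (4 * π) with hc
  rw [← integral_Ioc_eq_integral_Ioo, ← intervalIntegral.integral_of_le (by linarith [pi_pos])]
  have hper : Function.Periodic (fun θ => sectorExcess ρ c h (cos (θ - φ))) (2 * π) := by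
    intro θ
    simp only
    rw [show θ + 2 * π - φ = (θ - φ) + 2 * π by ring, cos_add_two_pi]
  -- Periodicity turns the normal of the line into direction 0.
  have e1 := hper.intervalIntegral_add_eq (-π) (φ - π)
  rw [show -π + 2 * π = π by ring, show φ - π + 2 * π = φ + π by ring] at e1
  rw [e1, intervalIntegral.integral_comp_sub_right (fun θ => sectorExcess ρ c h (cos θ)) φ,
    show φ - π - φ = -π by ring, show φ + π - φ = π by ring]
  -- If ρ ≤ h, the line misses the open disc and the integrand vanishes.
  rcases le_or_gt ρ h with hle | hlt
  · refine le_of_eq ?_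
    rw [intervalIntegral.integral_congr (g := fun _ => 0)]
    · simp
    intro θ _
    simp only [sectorExcess]
    rw [if_neg]
    have := cos_le_one θ
    nlinarith
  set α := arccos (h / ρ) with hα
  have hq0 : 0 < h / ρ := by positivity
  have hq1 : h / ρ < 1 := (div_lt_one hρ).2 hlt
  have hcosα : cos α = h / ρ := cos_arccos (by linarith) hq1.le
  have hα0 : 0 < α := arccos_pos.2 hq1
  have hα2 : α < π / 2 := arccos_lt_pi_div_two.2 hq0
  have hα6 : α ≤ π / 6 := by
    by_contra hcon
    push Not at hcon
    have := cos_lt_cos_of_nonneg_of_le_pi_div_two (x := π / 6) (y := α) (by positivity) hα2.le hcon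
    rw [cos_pi_div_six, hcosα, div_lt_iff₀ hρ] at this
    have h33 : √3 ^ 2 = 3 := sq_sqrt (by norm_num)
    nlinarith [mul_self_lt_mul_self hh.le this]
  have key : ∀ θ ∈ Ioc (-π) π, sectorExcess ρ c h (cos θ) =
      (Ioo (-α) α).indicator (fun θ => h ^ 2 * (1 / cos θ ^ 2) / 2 - c) θ := by
    intro θ hθ
    have habs : |θ| ≤ π := abs_le.2 ⟨hθ.1.le, hθ.2⟩
    have hiff : h < ρ * cos θ ↔ θ ∈ Ioo (-α) α := by
      rw [mul_comm, ← div_lt_iff₀ hρ, ← hcosα, ← cos_abs θ,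
        strictAntiOn_cos.lt_iff_gt ⟨hα0.le, by linarith [pi_pos]⟩ ⟨abs_nonneg _, habs⟩, abs_lt]
      rfl
    simp only [sectorExcess, indicator_apply, hiff]
    split_ifs with hm
    · congr 1; ring
    · rfl
  have hsub : Ioo (-α) α ⊆ Ioc (-π) π := fun θ hθ =>
    ⟨by linarith [hθ.1, pi_pos], by linarith [hθ.2, pi_pos]⟩
  rw [intervalIntegral.integral_of_le (by linarith [pi_pos]),
    setIntegral_congr_fun measurableSet_Ioc key, setIntegral_indicator measurableSet_Ioo,
    inter_eq_self_of_subset_right hsub, ← integral_Ioc_eq_integral_Ioo,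
    ← intervalIntegral.integral_of_le (by linarith)]
  have hcos : ∀ θ ∈ uIcc (-α) α, cos θ ≠ 0 := by
    intro θ hθ
    rw [uIcc_of_le (by linarith)] at hθ
    exact (cos_pos_of_mem_Ioo ⟨by linarith [hθ.1], by linarith [hθ.2]⟩).ne'
  rw [intervalIntegral.integral_eq_sub_of_hasDerivAt (f := fun θ => h ^ 2 * tan θ / 2 - c * θ)]
  · have hh2 : h ^ 2 = ρ ^ 2 * cos α ^ 2 := by rw [hcosα]; field_simp
    have hc0 : cos α ≠ 0 := by rw [hcosα]; exact hq0.ne'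
    have hs := mul_le_sin_of_le_pi_div_three (x := 2 * α) (by linarith) (by linarith)
    have e2 : h ^ 2 * tan α = ρ ^ 2 / 2 * sin (2 * α) := by
      rw [hh2, tan_eq_sin_div_cos, sin_two_mul]; field_simp
    have e3 : 2 * c * α = ρ ^ 2 / 2 * (3 * √3 / (2 * π) * (2 * α)) := by
      rw [hc]; field_simp; ring
    simp only [tan_neg]
    have := mul_le_mul_of_nonneg_left hs (by positivity : 0 ≤ ρ ^ 2 / 2)
    linarith
  · intro θ hθ
    simpa using! (((hasDerivAt_tan (hcos θ hθ)).const_mul (h ^ 2)).div_const 2).sub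
      ((hasDerivAt_id θ).const_mul c)
  · refine ContinuousOn.intervalIntegrable ?_
    have : ContinuousOn (fun θ => cos θ ^ 2) (uIcc (-α) α) := by fun_prop
    refine ContinuousOn.sub ?_ continuousOn_const
    refine ContinuousOn.div_const (continuousOn_const.mul ?_) _
    exact continuousOn_const.div this fun θ hθ => pow_ne_zero 2 (hcos θ hθ)

open Real Set in
/-- **Fejes Tóth's bound.** The Voronoi cell of the origin with respect to points at distance at
least `√3 ρ` from it and from each other, truncated to the disc of radius `ρ`, has at least the area
of the regular hexagon inscribed in the disc. -/
lemma volume_truncatedVoronoi_ge {ρ : ℝ} (hρ : 0 < ρ) (Q : Finset (ℝ × ℝ))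
    (hQ : ∀ q ∈ Q, 3 * ρ ^ 2 ≤ q.1 ^ 2 + q.2 ^ 2)
    (hQ2 : ∀ q ∈ Q, ∀ q' ∈ Q, q ≠ q' → 3 * ρ ^ 2 ≤ (q.1 - q'.1) ^ 2 + (q.2 - q'.2) ^ 2) :
    ENNReal.ofReal (3 * √3 / 2 * ρ ^ 2) ≤
      volume {x : ℝ × ℝ | x.1 ^ 2 + x.2 ^ 2 < ρ ^ 2 ∧
        ∀ q ∈ Q, 2 * (x.1 * q.1 + x.2 * q.2) < q.1 ^ 2 + q.2 ^ 2} := by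
  set c := ρ ^ 2 * (3 * √3) / (4 * π) with hc
  have hcpos : 0 < c := by positivity
  have hcle : c ≤ ρ ^ 2 / 2 := by
    rw [hc, div_le_div_iff₀ (by positivity) (by norm_num)]
    have h1 : √3 ≤ 2 := sqrt_le_iff.2 (by norm_num)
    have h2 := pi_gt_three
    have : 3 * √3 * 2 ≤ 4 * π := by linarith
    nlinarith [sq_nonneg ρ]
  set h : ℝ × ℝ → ℝ := fun q => √(q.1 ^ 2 + q.2 ^ 2) / 2 with hh
  set φ : ℝ × ℝ → ℝ := fun q => Complex.arg ⟨q.1, q.2⟩ with hφ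
  have hq1 : ∀ q : ℝ × ℝ, q.1 = 2 * h q * cos (φ q) := by
    intro q
    have := Complex.norm_mul_cos_arg ⟨q.1, q.2⟩
    rw [Complex.norm_eq_sqrt_sq_add_sq] at this
    simp only [hh, hφ]; simp only at this; linarith
  have hq2 : ∀ q : ℝ × ℝ, q.2 = 2 * h q * sin (φ q) := by
    intro q
    have := Complex.norm_mul_sin_arg ⟨q.1, q.2⟩
    rw [Complex.norm_eq_sqrt_sq_add_sq] at this
    simp only [hh, hφ]; simp only at this; linarith
  have hsq : ∀ q : ℝ × ℝ, q.1 ^ 2 + q.2 ^ 2 = 4 * h q ^ 2 := by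
    intro q
    simp only [hh, div_pow, sq_sqrt (by positivity : 0 ≤ q.1 ^ 2 + q.2 ^ 2)]; ring
  have hpos : ∀ q ∈ Q, 0 < h q := by
    intro q hq
    have := hQ q hq
    have h2 : 0 < q.1 ^ 2 + q.2 ^ 2 := by nlinarith [sq_pos_of_pos hρ]
    simp only [hh]; positivity
  have hinner : ∀ (q : ℝ × ℝ) (r θ : ℝ), r * cos θ * q.1 + r * sin θ * q.2 =
      2 * h q * (r * cos (θ - φ q)) := by
    intro q r θ
    rw [cos_sub]
    conv_lhs => rw [hq1 q, hq2 q]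
    ring
  -- In each direction at most one bisector cuts the disc. Otherwise the boundary point x in that
  -- direction is at distance less than ρ from q and q', and exactly ρ from 0. The squared mutual
  -- distances of three points sum to at most three times the sum of their squared distances from x,
  -- hence to less than 9ρ², while the separation gives at least 9ρ².
  have huniq : ∀ θ, ∀ q ∈ Q, ∀ q' ∈ Q, h q < ρ * cos (θ - φ q) → h q' < ρ * cos (θ - φ q') →
      q = q' := by
    intro θ q hq q' hq' hc1 hc2
    by_contra hne
    have a1 := hQ q hq
    have a2 := hQ q' hq'
    have a3 := hQ2 q hq q' hq' hne
    have b1 := hinner q ρ θ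
    have b2 := hinner q' ρ θ
    have d1 := mul_lt_mul_of_pos_left hc1 (hpos q hq)
    have d2 := mul_lt_mul_of_pos_left hc2 (hpos q' hq')
    have e1 := hsq q
    have e2 := hsq q'
    have cs : (ρ * cos θ) ^ 2 + (ρ * sin θ) ^ 2 = ρ ^ 2 := by
      have := cos_sq_add_sin_sq θ
      calc _ = ρ ^ 2 * (cos θ ^ 2 + sin θ ^ 2) := by ring
        _ = _ := by rw [this, mul_one]
    generalize ρ * cos θ = x at *
    generalize ρ * sin θ = y at *
    nlinarith [sq_nonneg (3 * x - q.1 - q'.1), sq_nonneg (3 * y - q.2 - q'.2)]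
  set g : ℝ → ℝ := fun θ => c + ∑ q ∈ Q, sectorExcess ρ c (h q) (cos (θ - φ q)) with hg
  have hfin : volume (Ioo (-π) π) ≠ ⊤ := measure_Ioo_lt_top.ne
  have hterm : ∀ q ∈ Q, IntegrableOn (fun θ => sectorExcess ρ c (h q) (cos (θ - φ q)))
      (Ioo (-π) π) := fun q hq => integrableOn_sectorExcess hρ hcpos.le (hpos q hq) _ hfin
  have hconst : IntegrableOn (fun _ : ℝ => c) (Ioo (-π) π) := integrableOn_const hfin
  have hsumint : IntegrableOn (fun θ => ∑ q ∈ Q, sectorExcess ρ c (h q) (cos (θ - φ q)))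
      (Ioo (-π) π) := integrable_finsetSum _ hterm
  have hint : IntegrableOn g (Ioo (-π) π) := hconst.add hsumint
  have hval : 3 * √3 / 2 * ρ ^ 2 ≤ ∫ θ in Ioo (-π) π, g θ := by
    rw [integral_add hconst hsumint, integral_finsetSum _ hterm]
    have h1 : ∫ _ in Ioo (-π) π, c = 3 * √3 / 2 * ρ ^ 2 := by
      rw [setIntegral_const, Measure.real, Real.volume_Ioo, ENNReal.toReal_ofReal
        (by linarith [pi_pos]), hc, smul_eq_mul]
      field_simp
      ring
    rw [h1]
    have : 0 ≤ ∑ q ∈ Q, ∫ θ in Ioo (-π) π, sectorExcess ρ c (h q) (cos (θ - φ q)) :=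
      Finset.sum_nonneg fun q hq => integral_sectorExcess_nonneg hρ (hpos q hq)
        (by rw [← hsq]; exact hQ q hq) _
    linarith
  -- R is the radius of the truncated cell: up to the one bisector met, where g = R²/2 exactly, or
  -- else ρ, where g = c ≤ ρ²/2.
  have hrad : ∀ θ, ∃ R, 0 ≤ R ∧ 0 ≤ g θ ∧ g θ ≤ R ^ 2 / 2 ∧ R ≤ ρ ∧
      ∀ q ∈ Q, ∀ r, 0 < r → r < R → r * cos (θ - φ q) < h q := by
    intro θ
    by_cases hq : ∃ q ∈ Q, h q < ρ * cos (θ - φ q)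
    · obtain ⟨q, hq, hlt⟩ := hq
      have ht : 0 < cos (θ - φ q) := by
        by_contra h'
        have := hpos q hq
        nlinarith
      have hgθ : g θ = (h q / cos (θ - φ q)) ^ 2 / 2 := by
        simp only [hg]
        rw [Finset.sum_eq_single_of_mem q hq]
        · rw [sectorExcess, if_pos hlt]; field_simp; ring
        · intro q' hq' hne
          rw [sectorExcess, if_neg]
          exact fun hlt' => hne (huniq θ q' hq' q hq hlt' hlt)
      have hRρ : h q / cos (θ - φ q) ≤ ρ := by rw [div_le_iff₀ ht]; exact hlt.le
      refine ⟨h q / cos (θ - φ q), (div_pos (hpos q hq) ht).le, by rw [hgθ]; positivity, hgθ.le,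
        hRρ, fun q' hq' r hr hrR => ?_⟩
      by_cases hqq : q' = q
      · subst hqq; exact (lt_div_iff₀ ht).1 hrR
      · have hn : ¬ h q' < ρ * cos (θ - φ q') := fun hlt' => hqq (huniq θ q' hq' q hq hlt' hlt)
        have := hpos q' hq'
        rcases le_or_gt (cos (θ - φ q')) 0 with h0 | h0
        · nlinarith
        · nlinarith
    · push Not at hq
      have hgθ : g θ = c := by
        simp only [hg]
        rw [Finset.sum_eq_zero, add_zero]
        intro q hq'
        rw [sectorExcess, if_neg (not_lt.2 (hq q hq'))]
      refine ⟨ρ, hρ.le, by rw [hgθ]; exact hcpos.le, by rw [hgθ]; exact hcle, le_rfl,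
        fun q' hq' r hr hrR => ?_⟩
      have := hpos q' hq'
      have := hq q' hq'
      rcases le_or_gt (cos (θ - φ q')) 0 with h0 | h0
      · nlinarith
      · nlinarith
  choose R hR0 hg0 hgR hRρ hin using hrad
  refine (ENNReal.ofReal_le_ofReal hval).trans
    (ofReal_integral_le_volume_of_radial ?_ hint hg0 hR0 hgR ?_)
  · refine (measurableSet_lt (f := fun x : ℝ × ℝ => x.1 ^ 2 + x.2 ^ 2) (by fun_prop)
      measurable_const).inter ?_
    refine (Finset.measurableSet_biInter Q (f := fun q : ℝ × ℝ => {x : ℝ × ℝ |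
      2 * (x.1 * q.1 + x.2 * q.2) < q.1 ^ 2 + q.2 ^ 2}) fun q _ =>
        measurableSet_lt (by fun_prop) measurable_const).congr ?_
    ext x; simp; rfl
  · intro θ r hr hrR
    refine ⟨?_, fun q hq => ?_⟩
    · have := cos_sq_add_sin_sq θ
      have e : (r * cos θ) ^ 2 + (r * sin θ) ^ 2 = r ^ 2 := by
        calc _ = r ^ 2 * (cos θ ^ 2 + sin θ ^ 2) := by ring
          _ = _ := by rw [this, mul_one]
      simp only [e]
      nlinarith [hRρ θ]
    · simp only [hinner q r θ, hsq q]
      have := hpos q hq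
      nlinarith [hin θ q hq r hr hrR]

open Real Set in
/-- Thue's bound for packings of discs of diameter `d`, in a form for a finite set in the unit
square. -/
lemma card_mul_le_of_separated {ι : Type*} (K : Finset ι) (p : ι → ℝ × ℝ) {d : ℝ} (hd : 0 < d)
    (hp : ∀ i ∈ K, p i ∈ Icc (0 : ℝ) 1 ×ˢ Icc (0 : ℝ) 1)
    (hsep : ∀ i ∈ K, ∀ j ∈ K, i ≠ j →
      d ^ 2 ≤ ((p i).1 - (p j).1) ^ 2 + ((p i).2 - (p j).2) ^ 2) :
    (K.card : ℝ) * (√3 / 2 * d ^ 2) ≤ (1 + 2 * (d / √3)) ^ 2 := by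
  classical
  set ρ := d / √3 with hρd
  have h33 : √3 ^ 2 = 3 := sq_sqrt (by norm_num)
  have hρ : 0 < ρ := by positivity
  have hρ2 : d ^ 2 = 3 * ρ ^ 2 := by rw [hρd, div_pow, h33]; ring
  -- Truncated Voronoi cells. Strict inequalities make them disjoint, and truncation keeps them
  -- within the unit square widened by ρ on each side.
  set T : ι → Set (ℝ × ℝ) := fun i => {x | (x.1 - (p i).1) ^ 2 + (x.2 - (p i).2) ^ 2 < ρ ^ 2 ∧
    ∀ j ∈ K, j ≠ i → (x.1 - (p i).1) ^ 2 + (x.2 - (p i).2) ^ 2 <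
      (x.1 - (p j).1) ^ 2 + (x.2 - (p j).2) ^ 2} with hT
  have hmeas : ∀ i ∈ K, MeasurableSet (T i) := by
    intro i _
    refine (measurableSet_lt (f := fun x : ℝ × ℝ => (x.1 - (p i).1) ^ 2 + (x.2 - (p i).2) ^ 2)
      (by fun_prop) measurable_const).inter ?_
    refine (Finset.measurableSet_biInter (K.erase i) (f := fun j => {x : ℝ × ℝ |
      (x.1 - (p i).1) ^ 2 + (x.2 - (p i).2) ^ 2 < (x.1 - (p j).1) ^ 2 + (x.2 - (p j).2) ^ 2})
        fun q _ => measurableSet_lt (by fun_prop) (by fun_prop)).congr ?_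
    ext x; simp only [Finset.mem_erase, mem_iInter, mem_ofPred_eq, and_imp]
    exact ⟨fun h j hj hne => h j hne hj, fun h j hne hj => h j hj hne⟩
  have hdisj : (K : Set ι).PairwiseDisjoint T := by
    intro i hi j hj hij
    refine Set.disjoint_left.2 fun x hxi hxj => ?_
    exact lt_asymm (hxi.2 j hj hij.symm) (hxj.2 i hi hij)
  have hvol : ∀ i ∈ K, ENNReal.ofReal (3 * √3 / 2 * ρ ^ 2) ≤ volume (T i) := by
    intro i hi
    refine (volume_truncatedVoronoi_ge hρ ((K.erase i).image fun j => p j - p i) ?_ ?_).trans ?_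
    · simp only [Finset.mem_image, Finset.mem_erase]
      rintro _ ⟨j, ⟨hj, hjK⟩, rfl⟩
      rw [← hρ2]; exact hsep j hjK i hi hj
    · simp only [Finset.mem_image, Finset.mem_erase]
      rintro _ ⟨j, ⟨hj, hjK⟩, rfl⟩ _ ⟨j', ⟨hj', hjK'⟩, rfl⟩ hne
      have := hsep j hjK j' hjK' (fun h => hne (by rw [h]))
      rw [← hρ2]
      simp only [Prod.fst_sub, Prod.snd_sub]
      convert this using 2 <;> ring
    · rw [← measure_preimage_add_right volume (p i) (T i)]
      refine measure_mono fun x hx => ?_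
      refine ⟨by simpa using hx.1, fun j hj hne => ?_⟩
      have := hx.2 (p j - p i) (Finset.mem_image.2 ⟨j, Finset.mem_erase.2 ⟨hne, hj⟩, rfl⟩)
      simp only [Prod.fst_sub, Prod.snd_sub, Prod.fst_add, Prod.snd_add] at this ⊢
      nlinarith
  have hsub : (⋃ i ∈ K, T i) ⊆ Icc (-ρ) (1 + ρ) ×ˢ Icc (-ρ) (1 + ρ) := by
    intro x hx
    simp only [mem_iUnion] at hx
    obtain ⟨i, hi, hx⟩ := hx
    obtain ⟨⟨a1, a2⟩, b1, b2⟩ := hp i hi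
    have h1 := abs_lt.1 (abs_lt_of_sq_lt_sq (a := x.1 - (p i).1) (b := ρ)
      (by nlinarith [hx.1, sq_nonneg (x.2 - (p i).2)]) hρ.le)
    have h2 := abs_lt.1 (abs_lt_of_sq_lt_sq (a := x.2 - (p i).2) (b := ρ)
      (by nlinarith [hx.1, sq_nonneg (x.1 - (p i).1)]) hρ.le)
    exact ⟨⟨by linarith, by linarith⟩, by linarith, by linarith⟩
  have htot : ENNReal.ofReal ((K.card : ℝ) * (3 * √3 / 2 * ρ ^ 2)) ≤
      ENNReal.ofReal ((1 + 2 * ρ) ^ 2) := by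
    calc ENNReal.ofReal ((K.card : ℝ) * (3 * √3 / 2 * ρ ^ 2))
        = ∑ i ∈ K, ENNReal.ofReal (3 * √3 / 2 * ρ ^ 2) := by
          rw [ENNReal.ofReal_mul (by positivity), ENNReal.ofReal_natCast, Finset.sum_const,
            nsmul_eq_mul]
      _ ≤ ∑ i ∈ K, volume (T i) := Finset.sum_le_sum hvol
      _ = volume (⋃ i ∈ K, T i) := (measure_biUnion_finset hdisj hmeas).symm
      _ ≤ volume (Icc (-ρ) (1 + ρ) ×ˢ Icc (-ρ) (1 + ρ)) := measure_mono hsub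
      _ = ENNReal.ofReal ((1 + 2 * ρ) ^ 2) := by
          rw [Measure.volume_eq_prod, Measure.prod_prod, Real.volume_Icc,
            ← ENNReal.ofReal_mul (by linarith)]
          congr 1; ring
  have := (ENNReal.ofReal_le_ofReal_iff (by positivity)).1 htot
  rw [hρ2]
  linarith

-- The square root of Thue's bound, solved for d; the term 2/√3 is the boundary effect.
open Real in
lemma separation_mul_le_one {ι : Type*} (K : Finset ι) (p : ι → ℝ × ℝ) {d : ℝ} (hd : 0 ≤ d)
    (hp : ∀ i ∈ K, p i ∈ Set.Icc (0 : ℝ) 1 ×ˢ Set.Icc (0 : ℝ) 1)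
    (hsep : ∀ i ∈ K, ∀ j ∈ K, i ≠ j →
      d ^ 2 ≤ ((p i).1 - (p j).1) ^ 2 + ((p i).2 - (p j).2) ^ 2) :
    d * (√(√3 / 2) * √(K.card : ℝ) - 2 / √3) ≤ 1 := by
  rcases hd.eq_or_lt with rfl | hd
  · simp
  have h := card_mul_le_of_separated K p hd hp hsep
  have h2 : (√(√3 / 2) * √(K.card : ℝ) * d) ^ 2 ≤ (1 + 2 * (d / √3)) ^ 2 := by
    rw [mul_pow, mul_pow, sq_sqrt (by positivity), sq_sqrt (by positivity)]
    linarith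
  have h3 := abs_le_of_sq_le_sq h2 (by positivity)
  have h4 := (abs_le.1 h3).2
  have : d * (2 / √3) = 2 * (d / √3) := by ring
  nlinarith

end Dispersion

namespace Dispersion

/-! ## Cells around the points of a nearly hexagonal lattice

The plane is scaled by `L`. The lattice has the points `(j + i / 2, i * rowHeight)`, and each of them is
the lower left corner of a square cell of side `cellSide`. -/

/-- A rational number just above √3/2, so that distinct lattice points still have distance at least
1. -/
noncomputable def rowHeight : ℝ := 8661 / 10000

noncomputable def cellSide : ℝ := 1 / 230

/-- The scale for the selection of `k` points. -/
noncomputable def scale (k : ℕ) : ℝ := √(217 * k / 250)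

noncomputable def rowOf (L y : ℝ) : ℤ := ⌊y * L / rowHeight⌋

noncomputable def colOf (L x y : ℝ) : ℤ := ⌊x * L - rowOf L y * (1 / 2)⌋

/-- The point `(x, y)` lies in a cell. -/
def InCell (L x y : ℝ) : Prop :=
  y * L - rowOf L y * rowHeight < cellSide ∧
    x * L - rowOf L y * (1 / 2) - colOf L x y < cellSide

lemma rowHeight_pos : 0 < rowHeight := by norm_num [rowHeight]

lemma rowOf_mul_le (L y : ℝ) : rowOf L y * rowHeight ≤ y * L := by
  have := Int.floor_le (y * L / rowHeight)
  rwa [le_div_iff₀ rowHeight_pos] at this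

/-- Points of different cells are almost as far apart as different points of the lattice. -/
lemma sq_dist_ge_of_cell_ne {L x y x' y' : ℝ} (h : InCell L x y) (h' : InCell L x' y')
    (hne : rowOf L y ≠ rowOf L y' ∨ colOf L x y ≠ colOf L x' y') :
    (19877 / 20000 : ℝ) ^ 2 ≤ L ^ 2 * ((x - x') ^ 2 + (y - y') ^ 2) := by
  obtain ⟨h1, h2⟩ := h
  obtain ⟨h1', h2'⟩ := h'
  have g1 := rowOf_mul_le L y
  have g1' := rowOf_mul_le L y'
  have g2 : (colOf L x y : ℝ) ≤ _ := Int.floor_le (x * L - rowOf L y * (1 / 2))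
  have g2' : (colOf L x' y' : ℝ) ≤ _ := Int.floor_le (x' * L - rowOf L y' * (1 / 2))
  generalize rowOf L y = i at *
  generalize rowOf L y' = i' at *
  generalize colOf L x y = j at *
  generalize colOf L x' y' = j' at *
  -- The norm form of the hexagonal lattice is a positive integer off the origin.
  have hint : 1 ≤ (j - j') ^ 2 + (i - i') * (j - j') + (i - i') ^ 2 := by
    have : 0 < (j - j') ^ 2 + (i - i') * (j - j') + (i - i') ^ 2 := by
      rcases hne with hne | hne
      · have := sq_pos_of_ne_zero (sub_ne_zero.2 hne)
        nlinarith [sq_nonneg (2 * (j - j') + (i - i'))]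
      · have := sq_pos_of_ne_zero (sub_ne_zero.2 hne)
        nlinarith [sq_nonneg (2 * (i - i') + (j - j'))]
    omega
  have hreal : (1 : ℝ) ≤ ((j : ℝ) - j') ^ 2 + ((i : ℝ) - i') * (j - j') + ((i : ℝ) - i') ^ 2 := by
    exact_mod_cast hint
  simp only [rowHeight, cellSide] at *
  set v1 : ℝ := ((j : ℝ) - j') + ((i : ℝ) - i') / 2 with hv1
  set v2 : ℝ := ((i : ℝ) - i') * (8661 / 10000) with hv2
  have hv : 1 ≤ v1 ^ 2 + v2 ^ 2 := by
    rw [hv1, hv2]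
    nlinarith [sq_nonneg ((i : ℝ) - i')]
  set w1 : ℝ := (x - x') * L - v1 with hw1
  set w2 : ℝ := (y - y') * L - v2 with hw2
  have e1 : w1 ^ 2 ≤ (1 / 230) ^ 2 := by
    apply sq_le_sq'
    · rw [hw1, hv1]; nlinarith
    · rw [hw1, hv1]; nlinarith
  have e2 : w2 ^ 2 ≤ (1 / 230) ^ 2 := by
    apply sq_le_sq'
    · rw [hw2, hv2]; nlinarith
    · rw [hw2, hv2]; nlinarith
  have e3 : L ^ 2 * ((x - x') ^ 2 + (y - y') ^ 2) = (v1 + w1) ^ 2 + (v2 + w2) ^ 2 := by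
    rw [hw1, hw2]; ring
  rw [e3]
  -- With ε = 123/20000, just above √2/230, one has |w| ≤ ε and |v| ≥ 1. Then |εv + w|² ≥ 0 yields
  -- |v + w| ≥ 1 - ε = 19877/20000.
  nlinarith [sq_nonneg (123 / 20000 * v1 + w1), sq_nonneg (123 / 20000 * v2 + w2)]

lemma scale_sq (k : ℕ) : scale k ^ 2 = 217 * k / 250 := Real.sq_sqrt (by positivity)

lemma scale_ge {k : ℕ} (hk : 3 * 10 ^ 5 ≤ k) : 510 ≤ scale k := by
  apply Real.le_sqrt_of_sq_le
  have : (3 * 10 ^ 5 : ℝ) ≤ k := by exact_mod_cast hk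
  linarith

/-- The cell of row `c.1` and column `c.2` is contained in the unit square. -/
def CellInSquare (L : ℝ) (c : ℤ × ℤ) : Prop :=
  0 ≤ (c.2 : ℝ) + c.1 / 2 ∧ (c.2 : ℝ) + c.1 / 2 + cellSide ≤ L ∧
    0 ≤ (c.1 : ℝ) ∧ c.1 * rowHeight + cellSide ≤ L

/-- The factor 217/250 = 0.868 in `scale` is slightly above `rowHeight`, the area per lattice point.
The surplus is of order L² and pays for the boundary loss of order L. -/
lemma exists_cells {k : ℕ} (hk : 3 * 10 ^ 5 ≤ k) :
    ∃ S : Finset (ℤ × ℤ), S.card = k ∧ ∀ c ∈ S, CellInSquare (scale k) c := by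
  set L := scale k with hL
  have hL0 : 510 ≤ L := scale_ge hk
  have hL2 : L ^ 2 = 217 * k / 250 := scale_sq k
  set R := ⌊(L - cellSide) / rowHeight⌋₊ + 1 with hR
  set M := ⌊L - 1 / 2 - cellSide⌋₊ + 1 with hM
  -- Subtracting half the row number from the column undoes the slant of the lattice: each row
  -- starts at abscissa 0 or 1/2.
  set f : ℕ × ℕ → ℤ × ℤ := fun a => ((a.1 : ℤ), (a.2 : ℤ) - (a.1 : ℤ) / 2) with hf
  have hinj : Function.Injective f := by
    rintro ⟨a, b⟩ ⟨a', b'⟩ h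
    simp only [hf, Prod.mk.injEq] at h ⊢
    omega
  set S := (Finset.range R ×ˢ Finset.range M).image f with hS
  have hcard : k ≤ S.card := by
    rw [hS, Finset.card_image_of_injective _ hinj, Finset.card_product, Finset.card_range,
      Finset.card_range]
    have h1 : (L - cellSide) / rowHeight ≤ R := by
      rw [hR]; push_cast; exact (Nat.lt_floor_add_one _).le
    have h2 : L - 1 / 2 - cellSide ≤ M := by
      rw [hM]; push_cast; exact (Nat.lt_floor_add_one _).le
    have h3 : (L - cellSide) / rowHeight * (L - 1 / 2 - cellSide) ≤ R * M := by
      refine mul_le_mul h1 h2 ?_ (by positivity)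
      norm_num [cellSide]; linarith
    have h4 : (k : ℝ) ≤ (L - cellSide) / rowHeight * (L - 1 / 2 - cellSide) := by
      rw [div_mul_eq_mul_div, le_div_iff₀ rowHeight_pos]
      simp only [rowHeight, cellSide]
      nlinarith
    exact_mod_cast h4.trans h3
  obtain ⟨S', hS', hS'c⟩ := Finset.exists_subset_card_eq hcard
  refine ⟨S', hS'c, fun c hc => ?_⟩
  obtain ⟨⟨a, b⟩, hab, rfl⟩ := Finset.mem_image.1 (hS' hc)
  simp only [Finset.mem_product, Finset.mem_range, hR, hM, Nat.lt_succ_iff] at hab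
  have hcs : cellSide = 1 / 230 := rfl
  have ha := (Nat.le_floor_iff (div_nonneg (by rw [hcs]; linarith) rowHeight_pos.le)).1 hab.1
  have hb := (Nat.le_floor_iff (by rw [hcs]; linarith)).1 hab.2
  rw [le_div_iff₀ rowHeight_pos] at ha
  have hdiv1 : (((a : ℤ) / 2 : ℤ) : ℝ) ≤ (a : ℝ) / 2 := by
    have : 2 * ((a : ℤ) / 2) ≤ a := by omega
    have : (2 * (((a : ℤ) / 2 : ℤ) : ℝ)) ≤ a := by exact_mod_cast this
    linarith
  have hdiv2 : (a : ℝ) / 2 ≤ (((a : ℤ) / 2 : ℤ) : ℝ) + 1 / 2 := by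
    have : (a : ℤ) ≤ 2 * ((a : ℤ) / 2) + 1 := by omega
    have : (a : ℝ) ≤ (2 * (((a : ℤ) / 2 : ℤ) : ℝ)) + 1 := by exact_mod_cast this
    linarith
  have hb0 : (0 : ℝ) ≤ b := by positivity
  simp only [CellInSquare, hf, Int.cast_sub, Int.cast_natCast]
  refine ⟨?_, ?_, by positivity, ?_⟩ <;> linarith

/-- The cell of row `c.1` and column `c.2`. -/
def cell (L : ℝ) (c : ℤ × ℤ) : Set Plane :=
  {x | (c.2 + c.1 / 2) / L ≤ x 0 ∧ x 0 < (c.2 + c.1 / 2 + cellSide) / L ∧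
    c.1 * rowHeight / L ≤ x 1 ∧ x 1 < (c.1 * rowHeight + cellSide) / L}

lemma mem_cell {L : ℝ} (hL : 0 < L) {c : ℤ × ℤ} {x : Plane} (hx : x ∈ cell L c) :
    rowOf L (x 1) = c.1 ∧ colOf L (x 0) (x 1) = c.2 ∧ InCell L (x 0) (x 1) := by
  obtain ⟨h1, h2, h3, h4⟩ := hx
  rw [div_le_iff₀ hL] at h1 h3
  rw [lt_div_iff₀ hL] at h2 h4
  have hrow : rowOf L (x 1) = c.1 := by
    rw [rowOf, Int.floor_eq_iff, le_div_iff₀ rowHeight_pos, div_lt_iff₀ rowHeight_pos]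
    refine ⟨h3, h4.trans ?_⟩
    simp only [rowHeight, cellSide]; linarith
  have hcol : colOf L (x 0) (x 1) = c.2 := by
    rw [colOf, hrow, Int.floor_eq_iff]
    refine ⟨by linarith, ?_⟩
    simp only [cellSide] at h2; linarith
  refine ⟨hrow, hcol, ?_⟩
  rw [InCell, hrow, hcol]
  constructor <;> linarith

open Real in
/-- The optimum is at most slightly larger than the lattice spacing `1 / L`. -/
lemma scaled_opt_le {k : ℕ} (hk : 3 * 10 ^ 5 ≤ k) {d : ℝ} (hd : 0 ≤ d)
    (h : d * (√(√3 / 2) * √(k : ℝ) - 2 / √3) ≤ 1) :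
    0.99 * d ≤ 19877 / 20000 / scale k := by
  have hk' : (3 * 10 ^ 5 : ℝ) ≤ k := by exact_mod_cast hk
  have hs3 : (1.73205 : ℝ) ≤ √3 := le_sqrt_of_sq_le (by norm_num)
  have h1 : (0.9306 : ℝ) ≤ √(√3 / 2) := le_sqrt_of_sq_le (by linarith)
  have h2 : 2 / √3 ≤ 1.1548 := by
    rw [div_le_iff₀ (by positivity)]; linarith
  have h3 : (547.7 : ℝ) ≤ √(k : ℝ) := le_sqrt_of_sq_le (by linarith)
  have h4 : scale k ≤ 0.93167 * √(k : ℝ) := by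
    rw [scale, sqrt_le_left (by positivity), mul_pow, sq_sqrt (by positivity)]
    linarith
  have hL : 0 < scale k := lt_of_lt_of_le (by norm_num) (scale_ge hk)
  rw [le_div_iff₀ hL]
  have h5 : 0.99 * scale k ≤ 19877 / 20000 * (√(√3 / 2) * √(k : ℝ) - 2 / √3) := by
    have := mul_le_mul_of_nonneg_right h1 (sqrt_nonneg (k : ℝ))
    linarith
  nlinarith [mul_le_mul_of_nonneg_left h5 hd]

/-! ### The probability that random points hit prescribed cells. -/

lemma measurableSet_unitSquare : MeasurableSet unitSquare := by
  have : unitSquare = ⋂ j : Fin 2, (fun x : Plane => x j) ⁻¹' Set.Icc (0 : ℝ) 1 := by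
    ext x; simp [unitSquare]
  rw [this]
  exact MeasurableSet.iInter fun j => measurableSet_Icc.preimage (by fun_prop)

lemma volume_unitSquare : volume unitSquare = 1 := by
  have : unitSquare = (WithLp.ofLp : Plane → Fin 2 → ℝ) ⁻¹'
      (Set.univ.pi fun _ : Fin 2 => Set.Icc (0 : ℝ) 1) := by
    ext x; simp only [unitSquare, Set.mem_preimage, Set.mem_univ_pi]; rfl
  rw [this, (PiLp.volume_preserving_ofLp (Fin 2)).measure_preimage
    (MeasurableSet.univ_pi fun _ => measurableSet_Icc).nullMeasurableSet, volume_pi_pi]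
  simp

lemma cell_eq_preimage (L : ℝ) (c : ℤ × ℤ) : cell L c = (WithLp.ofLp : Plane → Fin 2 → ℝ) ⁻¹'
    (Set.univ.pi ![Set.Ico ((c.2 + c.1 / 2) / L) ((c.2 + c.1 / 2 + cellSide) / L),
      Set.Ico (c.1 * rowHeight / L) ((c.1 * rowHeight + cellSide) / L)]) := by
  ext x
  simp [cell, and_assoc]

lemma measurableSet_pi_cell (L : ℝ) (c : ℤ × ℤ) : MeasurableSet
    (Set.univ.pi ![Set.Ico (((c.2 : ℝ) + c.1 / 2) / L) ((c.2 + c.1 / 2 + cellSide) / L),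
      Set.Ico (c.1 * rowHeight / L) ((c.1 * rowHeight + cellSide) / L)]) := by
  refine MeasurableSet.univ_pi fun j => ?_
  fin_cases j <;> exact measurableSet_Ico

lemma measurableSet_cell (L : ℝ) (c : ℤ × ℤ) : MeasurableSet (cell L c) := by
  rw [cell_eq_preimage]
  exact (measurableSet_pi_cell L c).preimage (PiLp.volume_preserving_ofLp (Fin 2)).measurable

lemma volume_cell {L : ℝ} (hL : 0 < L) (c : ℤ × ℤ) :
    volume (cell L c) = ENNReal.ofReal ((cellSide / L) ^ 2) := by
  rw [cell_eq_preimage, (PiLp.volume_preserving_ofLp (Fin 2)).measure_preimage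
    (measurableSet_pi_cell L c).nullMeasurableSet, volume_pi_pi, Fin.prod_univ_two]
  have : 0 ≤ cellSide / L := div_nonneg (by norm_num [cellSide]) hL.le
  simp only [Matrix.cons_val_zero, Matrix.cons_val_one, Real.volume_Ico]
  rw [sq, ENNReal.ofReal_mul this]
  congr 2 <;> ring

lemma cell_subset_unitSquare {L : ℝ} (hL : 0 < L) {c : ℤ × ℤ} (hc : CellInSquare L c) :
    cell L c ⊆ unitSquare := by
  intro x hx
  obtain ⟨h1, h2, h3, h4⟩ := hx
  obtain ⟨c1, c2, c3, c4⟩ := hc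
  have e1 := div_nonneg c1 hL.le
  have e2 := (div_le_one hL).2 c2
  have e3 := div_nonneg (mul_nonneg c3 rowHeight_pos.le) hL.le
  have e4 := (div_le_one hL).2 c4
  intro j
  fin_cases j
  · exact ⟨e1.trans h1, h2.le.trans e2⟩
  · exact ⟨e3.trans h3, h4.le.trans e4⟩

/-- If each of the sets `A c`, `c ∈ S`, has measure at least `q`, then `n` independent points hit all
of them with probability at least `1 - |S| exp (-q n)`. -/
lemma measure_forall_hit_ge {α ι : Type*} [MeasurableSpace α] (ν : Measure α) [IsProbabilityMeasure ν]
    (n : ℕ) {U : Set α} (hU : MeasurableSet U) (hU1 : ν U = 1) (S : Finset ι) {A : ι → Set α}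
    (hA : ∀ c, MeasurableSet (A c)) {q : ℝ} (hq : ∀ c ∈ S, ENNReal.ofReal q ≤ ν (A c)) (hq1 : q ≤ 1) :
    MeasurableSet {p : Fin n → α | (∀ i, p i ∈ U) ∧ ∀ c ∈ S, ∃ i, p i ∈ A c} ∧
    ENNReal.ofReal (1 - S.card * Real.exp (-(q * n))) ≤
      Measure.pi (fun _ : Fin n => ν) {p | (∀ i, p i ∈ U) ∧ ∀ c ∈ S, ∃ i, p i ∈ A c} := by
  set E := {p : Fin n → α | (∀ i, p i ∈ U) ∧ ∀ c ∈ S, ∃ i, p i ∈ A c} with hE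
  set P := Measure.pi (fun _ : Fin n => ν)
  have hEq : Eᶜ = (⋃ i, Function.eval i ⁻¹' Uᶜ) ∪ ⋃ c ∈ S, Set.univ.pi fun _ => (A c)ᶜ := by
    ext p
    simp only [hE, Set.mem_compl_iff, Set.mem_ofPred_eq, Set.mem_union, Set.mem_iUnion,
      Set.mem_preimage, Function.eval, Set.mem_univ_pi, exists_prop, not_and_or]
    push Not
    rfl
  have hm1 : ∀ i : Fin n, MeasurableSet ((Function.eval i : (Fin n → α) → α) ⁻¹' Uᶜ) := fun i =>
    hU.compl.preimage (measurable_pi_apply i)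
  have hm2 : ∀ c, MeasurableSet (Set.univ.pi fun _ : Fin n => (A c)ᶜ) := fun c =>
    MeasurableSet.univ_pi fun _ => (hA c).compl
  have hEm : MeasurableSet E := by
    rw [← compl_compl E, hEq]
    exact ((MeasurableSet.iUnion hm1).union (Finset.measurableSet_biUnion _ fun c _ => hm2 c)).compl
  refine ⟨hEm, ?_⟩
  have h1 : P (⋃ i, Function.eval i ⁻¹' Uᶜ) = 0 := by
    refine measure_iUnion_null fun i => ?_
    rw [(measurePreserving_eval (fun _ : Fin n => ν) i).measure_preimage hU.compl.nullMeasurableSet,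
      prob_compl_eq_zero_iff hU]
    exact hU1
  have h2 : ∀ c ∈ S, P (Set.univ.pi fun _ => (A c)ᶜ) ≤ ENNReal.ofReal (Real.exp (-(q * n))) := by
    intro c hc
    rw [Measure.pi_pi, Finset.prod_const, Finset.card_univ, Fintype.card_fin,
      prob_compl_eq_one_sub (hA c)]
    have h3 : 1 - ν (A c) ≤ ENNReal.ofReal (1 - q) := by
      rw [tsub_le_iff_right]
      refine le_trans ?_ (add_le_add_right (hq c hc) _)
      refine le_trans ?_ ENNReal.ofReal_add_le
      simp
    refine (pow_le_pow_left₀ zero_le h3 n).trans ?_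
    rw [← ENNReal.ofReal_pow (by linarith)]
    refine ENNReal.ofReal_le_ofReal ?_
    have h4 : 1 - q ≤ Real.exp (-q) := by linarith [Real.add_one_le_exp (-q)]
    calc (1 - q) ^ n ≤ Real.exp (-q) ^ n := pow_le_pow_left₀ (by linarith) h4 n
      _ = Real.exp (-(q * n)) := by rw [← Real.exp_nat_mul]; congr 1; ring
  have h5 : P Eᶜ ≤ ENNReal.ofReal (S.card * Real.exp (-(q * n))) := by
    rw [hEq]
    refine (measure_union_le _ _).trans ?_
    rw [h1, zero_add]
    refine (measure_biUnion_finset_le _ _).trans ((Finset.sum_le_sum h2).trans ?_)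
    rw [Finset.sum_const, nsmul_eq_mul, ENNReal.ofReal_mul (by positivity), ENNReal.ofReal_natCast]
  have h6 : P E = 1 - P Eᶜ := by
    rw [← prob_compl_eq_one_sub hEm.compl, compl_compl]
  rw [h6, ENNReal.ofReal_sub _ (by positivity), ENNReal.ofReal_one]
  exact tsub_le_tsub_left h5 1

/-- Random points hit all of `k` cells in the unit square with probability at least `1 - 1 / n`. -/
lemma uniformPoints_hit_cells_ge {n k : ℕ} (hn : 3 ≤ n) (hk : 3 * 10 ^ 5 ≤ k)
    (hkn : (k : ℝ) ≤ (n : ℝ) / (10 ^ 5 * Real.log (n : ℝ))) {S : Finset (ℤ × ℤ)} (hS : S.card = k)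
    (hc : ∀ c ∈ S, CellInSquare (scale k) c) :
    MeasurableSet {p : Fin n → Plane | (∀ i, p i ∈ unitSquare) ∧
      ∀ c ∈ S, ∃ i, p i ∈ cell (scale k) c} ∧
    ENNReal.ofReal (1 - 1 / (n : ℝ)) ≤ uniformPoints n {p | (∀ i, p i ∈ unitSquare) ∧
      ∀ c ∈ S, ∃ i, p i ∈ cell (scale k) c} := by
  have hL : 0 < scale k := lt_of_lt_of_le (by norm_num) (scale_ge hk)
  have hL2 := scale_sq k
  have hk' : (3 * 10 ^ 5 : ℝ) ≤ k := by exact_mod_cast hk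
  have hn' : (3 : ℝ) ≤ n := by exact_mod_cast hn
  have hlog : 1 ≤ Real.log n := by
    rw [Real.le_log_iff_exp_le (by linarith)]
    linarith [Real.exp_one_lt_d9]
  have : IsProbabilityMeasure (ProbabilityTheory.cond (volume : Measure Plane) unitSquare) :=
    ProbabilityTheory.cond_isProbabilityMeasure_of_finite (by simp [volume_unitSquare])
      (by simp [volume_unitSquare])
  have hcond : ∀ B ⊆ unitSquare, ProbabilityTheory.cond (volume : Measure Plane) unitSquare B =
      volume B := by
    intro B hB
    rw [ProbabilityTheory.cond_apply measurableSet_unitSquare, volume_unitSquare,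
      Set.inter_eq_self_of_subset_right hB]
    simp
  have hqv : (cellSide / scale k) ^ 2 = 250 / (52900 * 217 * k) := by
    rw [div_pow, hL2, cellSide]; field_simp; norm_num
  obtain ⟨h1, h2⟩ := measure_forall_hit_ge (q := (cellSide / scale k) ^ 2)
    (ProbabilityTheory.cond (volume : Measure Plane) unitSquare) n measurableSet_unitSquare
    (by rw [hcond _ subset_rfl, volume_unitSquare]) S (measurableSet_cell (scale k))
    (fun c hcS => by rw [hcond _ (cell_subset_unitSquare hL (hc c hcS)), volume_cell hL])
    (by rw [hqv, div_le_one (by positivity)]; linarith)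
  refine ⟨h1, le_trans (ENNReal.ofReal_le_ofReal ?_) h2⟩
  rw [hS, hqv]
  rw [le_div_iff₀ (by positivity)] at hkn
  -- 250 · 10⁵ / (52900 · 217) is about 2.18, so the exponent is at most -2 log n.
  have hexp : Real.exp (-(250 / (52900 * 217 * k) * n)) ≤ 1 / (n : ℝ) ^ 2 := by
    rw [← Real.exp_log (show (0 : ℝ) < 1 / (n : ℝ) ^ 2 by positivity), Real.exp_le_exp, one_div,
      Real.log_inv, Real.log_pow, neg_le_neg_iff, div_mul_eq_mul_div, le_div_iff₀ (by positivity)]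
    push_cast
    nlinarith [mul_nonneg (by linarith : (0 : ℝ) ≤ k) (by linarith : 0 ≤ Real.log n)]
  have hkn2 : (k : ℝ) ≤ n := by nlinarith
  have : (k : ℝ) * Real.exp (-(250 / (52900 * 217 * k) * n)) ≤ 1 / n := by
    calc _ ≤ (n : ℝ) * (1 / (n : ℝ) ^ 2) := mul_le_mul hkn2 hexp (Real.exp_pos _).le (by positivity)
      _ = 1 / n := by field_simp
  linarith

end Dispersion

namespace RealRAM

/-! ## Reasoning about programs -/

/-- With word bound `W`, the program `p` started in `s` halts within `T` steps in a configuration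
that satisfies `Q`. -/
def Runs (W : ℕ) (p : Prog) (s : State) (T : ℕ) (Q : State → Prop) : Prop :=
  ∃ (t : ℕ) (s' : State), t ≤ T ∧ Exec W p s t s' ∧ Q s'

def State.withInt (s : State) (d : ℕ) (v : ℤ) : State :=
  { s with ireg := Function.update s.ireg d v }

section
variable (s : State) (d : ℕ) (v : ℤ) (w : ℝ)

@[simp] lemma State.withInt_ireg (e : ℕ) :
    (s.withInt d v).ireg e = if e = d then v else s.ireg e := by
  simp [State.withInt, Function.update_apply]
@[simp] lemma State.withInt_rreg : (s.withInt d v).rreg = s.rreg := rfl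
@[simp] lemma State.withInt_imem : (s.withInt d v).imem = s.imem := rfl
@[simp] lemma State.withInt_rmem : (s.withInt d v).rmem = s.rmem := rfl
@[simp] lemma State.withInt_out : (s.withInt d v).out = s.out := rfl
@[simp] lemma State.setReal_rreg (e : ℕ) :
    (s.setReal d w).rreg e = if e = d then w else s.rreg e := by
  simp [State.setReal, Function.update_apply]
@[simp] lemma State.setReal_ireg : (s.setReal d w).ireg = s.ireg := rfl
@[simp] lemma State.setReal_imem : (s.setReal d w).imem = s.imem := rfl
@[simp] lemma State.setReal_rmem : (s.setReal d w).rmem = s.rmem := rfl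
@[simp] lemma State.setReal_out : (s.setReal d w).out = s.out := rfl

end

variable {W T T' : ℕ} {s : State} {Q Q' : State → Prop} {p q : Prog}

lemma Runs.mono (h : Runs W p s T Q) (hT : T ≤ T') (hQ : ∀ s', Q s' → Q' s') :
    Runs W p s T' Q' := by
  obtain ⟨t, s', ht, he, hq⟩ := h
  exact ⟨t, s', ht.trans hT, he, hQ _ hq⟩

lemma Runs.seq (h : Runs W p s T fun s' => Runs W q s' T' Q) :
    Runs W (.seq p q) s (T + T') Q := by
  obtain ⟨t, s', ht, he, t', s'', ht', he', hq⟩ := h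
  exact ⟨t + t', s'', add_le_add ht ht', .seq he he', hq⟩

lemma Runs.nop (h : Q s) : Runs W .nop s 1 Q := ⟨1, s, le_rfl, .nop s, h⟩

lemma Runs.instr {i : Instr} {s' : State} (hs : i.step W s = some s') (h : Q s') :
    Runs W (.instr i) s 1 Q := ⟨1, s', le_rfl, .instr hs, h⟩

lemma Runs.branch {c : Test} (h : c.Holds s → Runs W p s T Q)
    (h' : ¬ c.Holds s → Runs W q s T Q) : Runs W (.branch c p q) s (1 + T) Q := by
  by_cases hc : c.Holds s
  · obtain ⟨t, s', ht, he, hq⟩ := h hc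
    exact ⟨1 + t, s', by omega, .branch_true hc he, hq⟩
  · obtain ⟨t, s', ht, he, hq⟩ := h' hc
    exact ⟨1 + t, s', by omega, .branch_false hc he, hq⟩

/-- A loop with invariant `I`, indexed by the number of completed iterations. -/
lemma Runs.loop {c : Test} {I : ℕ → State → Prop} {n : ℕ}
    (hlt : ∀ m s, I m s → m < n → c.Holds s ∧ Runs W p s T (I (m + 1)))
    (hge : ∀ s, I n s → ¬ c.Holds s) {m : ℕ} (hm : m ≤ n) (h : I m s) :
    Runs W (.loop c p) s ((T + 1) * (n - m) + 1) (I n) := by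
  obtain ⟨r, hr⟩ := Nat.exists_eq_add_of_le hm
  rw [show n - m = r by omega]
  clear hm
  induction r generalizing m s with
  | zero =>
    obtain rfl : n = m := by omega
    exact ⟨1, s, by omega, .loop_false (hge s h), h⟩
  | succ r ih =>
    obtain ⟨hc, t, s', ht, he, hs'⟩ := hlt m s h (by omega)
    obtain ⟨t', s'', ht', he', hs''⟩ := ih hs' (by omega)
    refine ⟨1 + t + t', s'', ?_, .loop_true hc he he', hs''⟩
    rw [mul_add]
    omega

/-- Straight-line programs. -/
def block : List Instr → Prog
  | [] => .nop
  | i :: is => .seq (.instr i) (block is)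

variable {is : List Instr}

lemma Runs.cons {i : Instr} {s' : State} (hs : i.step W s = some s')
    (h : Runs W (block is) s' T Q) : Runs W (block (i :: is)) s (T + 1) Q :=
  (Runs.seq (.instr hs h)).mono (Nat.add_comm 1 T).le fun _ h => h

lemma Runs.iconst {d : ℕ} {c : ℤ} (hb : |c| ≤ (W : ℤ))
    (h : Runs W (block is) (s.withInt d c) T Q) :
    Runs W (block (.iconst d c :: is)) s (T + 1) Q :=
  .cons (by simp only [Instr.step, State.setInt, if_pos hb]; rfl) h

lemma Runs.iop {op : IntOp} {d a b : ℕ} {v : ℤ} (hv : op.eval (s.ireg a) (s.ireg b) = v)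
    (hb : |v| ≤ (W : ℤ)) (h : Runs W (block is) (s.withInt d v) T Q) :
    Runs W (block (.iop op d a b :: is)) s (T + 1) Q :=
  .cons (by subst hv; simp only [Instr.step, State.setInt, if_pos hb]; rfl) h

lemma Runs.floor {d a : ℕ} {v : ℤ} (hv : ⌊s.rreg a⌋ = v) (hb : |v| ≤ (W : ℤ))
    (h : Runs W (block is) (s.withInt d v) T Q) :
    Runs W (block (.floor d a :: is)) s (T + 1) Q :=
  .cons (by subst hv; simp only [Instr.step, State.setInt, if_pos hb]; rfl) h

lemma Runs.iload {d a : ℕ} {v : ℤ} (hv : s.imem (s.ireg a) = v) (hb : |v| ≤ (W : ℤ))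
    (h : Runs W (block is) (s.withInt d v) T Q) :
    Runs W (block (.iload d a :: is)) s (T + 1) Q :=
  .cons (by subst hv; simp only [Instr.step, State.setInt, if_pos hb]; rfl) h

lemma Runs.toReal {d a : ℕ} {v : ℝ} (hv : (s.ireg a : ℝ) = v)
    (h : Runs W (block is) (s.setReal d v) T Q) :
    Runs W (block (.toReal d a :: is)) s (T + 1) Q :=
  .cons (by subst hv; rfl) h

lemma Runs.rop {op : RealOp} {d a b : ℕ} {v : ℝ} (hv : op.eval (s.rreg a) (s.rreg b) = some v)
    (h : Runs W (block is) (s.setReal d v) T Q) :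
    Runs W (block (.rop op d a b :: is)) s (T + 1) Q :=
  .cons (by simp only [Instr.step, hv]; rfl) h

lemma Runs.rsqrt {d a : ℕ} {v : ℝ} (h0 : 0 ≤ s.rreg a) (hv : √(s.rreg a) = v)
    (h : Runs W (block is) (s.setReal d v) T Q) :
    Runs W (block (.rsqrt d a :: is)) s (T + 1) Q :=
  .cons (by subst hv; simp only [Instr.step, if_neg (not_lt.2 h0)]) h

lemma Runs.rload {d a : ℕ} {v : ℝ} (hv : s.rmem (s.ireg a) = v)
    (h : Runs W (block is) (s.setReal d v) T Q) :
    Runs W (block (.rload d a :: is)) s (T + 1) Q :=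
  .cons (by subst hv; rfl) h

end RealRAM

namespace Dispersion

/-! ## The selection: one point from each cell that is hit -/

/-- The number by which a cell is represented in the machine. -/
noncomputable def cellId (L : ℝ) (x : Plane) : ℤ :=
  rowOf L (x 1) * (⌊2 * L⌋ + 2) + colOf L (x 0) (x 1)

/-- The points `l` are selected from the first `t` of the points `p`. -/
structure IsSelection {n : ℕ} (L : ℝ) (k : ℕ) (p : Fin n → Plane) (t : ℕ) (l : List (Fin n)) :
    Prop where
  nodup : l.Nodup
  lt : ∀ u ∈ l, (u : ℕ) < t
  inCell : ∀ u ∈ l, InCell L (p u 0) (p u 1)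
  inj : ∀ u ∈ l, ∀ v ∈ l, cellId L (p u) = cellId L (p v) → u = v
  length_le : l.length ≤ k
  complete : ∀ u : Fin n, (u : ℕ) < t → InCell L (p u 0) (p u 1) →
    l.length = k ∨ ∃ v ∈ l, cellId L (p v) = cellId L (p u)

variable {n k t : ℕ} {L : ℝ} {p : Fin n → Plane} {l : List (Fin n)}

lemma IsSelection.nil : IsSelection L k p 0 [] := by constructor <;> simp

lemma IsSelection.skip (h : IsSelection L k p t l) (ht : t < n)
    (hs : InCell L (p ⟨t, ht⟩ 0) (p ⟨t, ht⟩ 1) →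
      l.length = k ∨ ∃ v ∈ l, cellId L (p v) = cellId L (p ⟨t, ht⟩)) :
    IsSelection L k p (t + 1) l where
  nodup := h.nodup
  lt u hu := (h.lt u hu).trans (Nat.lt_succ_self t)
  inCell := h.inCell
  inj := h.inj
  length_le := h.length_le
  complete u hu hc := by
    rcases Nat.lt_succ_iff_lt_or_eq.1 hu with hlt | heq
    · exact h.complete u hlt hc
    · obtain rfl : u = ⟨t, ht⟩ := Fin.ext heq
      exact hs hc

lemma IsSelection.append (h : IsSelection L k p t l) (ht : t < n)
    (hc : InCell L (p ⟨t, ht⟩ 0) (p ⟨t, ht⟩ 1)) (hlt : l.length < k)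
    (hn : ∀ v ∈ l, cellId L (p v) ≠ cellId L (p ⟨t, ht⟩)) :
    IsSelection L k p (t + 1) (l ++ [⟨t, ht⟩]) where
  nodup := by
    refine List.nodup_append.2 ⟨h.nodup, List.nodup_singleton _, fun a ha b hb => ?_⟩
    rw [List.mem_singleton.1 hb]
    rintro rfl
    exact hn _ ha rfl
  lt u hu := by
    rcases List.mem_append.1 hu with hu | hu
    · exact (h.lt u hu).trans (Nat.lt_succ_self t)
    · rw [List.mem_singleton.1 hu]; exact Nat.lt_succ_self t
  inCell u hu := by
    rcases List.mem_append.1 hu with hu | hu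
    · exact h.inCell u hu
    · rw [List.mem_singleton.1 hu]; exact hc
  inj u hu v hv huv := by
    rcases List.mem_append.1 hu with hu | hu <;> rcases List.mem_append.1 hv with hv | hv
    · exact h.inj u hu v hv huv
    · rw [List.mem_singleton.1 hv] at huv; exact absurd huv (hn u hu)
    · rw [List.mem_singleton.1 hu] at huv; exact absurd huv.symm (hn v hv)
    · rw [List.mem_singleton.1 hu, List.mem_singleton.1 hv]
  length_le := by rw [List.length_append, List.length_singleton]; omega
  complete u hu hcu := by
    rcases Nat.lt_succ_iff_lt_or_eq.1 hu with hlt' | heq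
    · rcases h.complete u hlt' hcu with hl | ⟨v, hv, hvu⟩
      · omega
      · exact .inr ⟨v, List.mem_append_left _ hv, hvu⟩
    · obtain rfl : u = ⟨t, ht⟩ := Fin.ext heq
      exact .inr ⟨_, List.mem_append_right _ (List.mem_singleton.2 rfl), rfl⟩

lemma rowOf_mem {L y : ℝ} (hL : 510 ≤ L) (hy : y ∈ Set.Icc (0 : ℝ) 1) :
    0 ≤ rowOf L y ∧ (rowOf L y : ℝ) ≤ 1.1547 * L := by
  have h0 : 0 ≤ y * L := mul_nonneg hy.1 (by linarith)
  refine ⟨Int.floor_nonneg.2 (div_nonneg h0 rowHeight_pos.le), ?_⟩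
  have h1 := rowOf_mul_le L y
  have h2 : y * L ≤ L := mul_le_of_le_one_left (by linarith) hy.2
  simp only [rowHeight] at h1
  nlinarith

lemma colOf_mem {L x y : ℝ} (hL : 510 ≤ L) (hx : x ∈ Set.Icc (0 : ℝ) 1)
    (hy : y ∈ Set.Icc (0 : ℝ) 1) :
    -(0.58 * L + 1) ≤ (colOf L x y : ℝ) ∧ (colOf L x y : ℝ) ≤ L := by
  obtain ⟨h1, h2⟩ := rowOf_mem hL hy
  have h1' : (0 : ℝ) ≤ rowOf L y := by exact_mod_cast h1
  have h3 : (colOf L x y : ℝ) ≤ _ := Int.floor_le (x * L - rowOf L y * (1 / 2))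
  have h4 : _ < (colOf L x y : ℝ) + 1 := Int.lt_floor_add_one (x * L - rowOf L y * (1 / 2))
  have h5 : 0 ≤ x * L := mul_nonneg hx.1 (by linarith)
  have h6 : x * L ≤ L := mul_le_of_le_one_left (by linarith) hx.2
  constructor <;> linarith

lemma cellId_bounds {L : ℝ} (hL : 510 ≤ L) {x : Plane} (hx : x ∈ unitSquare) :
    |(rowOf L (x 1) * (⌊2 * L⌋ + 2) : ℤ)| ≤ 3 * L ^ 2 ∧ |(cellId L x : ℝ)| ≤ 3 * L ^ 2 := by
  obtain ⟨h1, h2⟩ := rowOf_mem hL (hx 1)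
  obtain ⟨h3, h4⟩ := colOf_mem hL (hx 0) (hx 1)
  have h1' : (0 : ℝ) ≤ rowOf L (x 1) := by exact_mod_cast h1
  have h5 := Int.floor_le (2 * L)
  have h6 := Int.lt_floor_add_one (2 * L)
  have h7 : (rowOf L (x 1) : ℝ) * (⌊2 * L⌋ + 2) ≤ 1.1547 * L * (2 * L + 2) :=
    mul_le_mul h2 (by linarith) (by linarith) (by linarith)
  have h8 : 0 ≤ (rowOf L (x 1) : ℝ) * (⌊2 * L⌋ + 2) := mul_nonneg h1' (by linarith)
  simp only [cellId]
  push_cast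
  refine ⟨?_, ?_⟩
  · rw [abs_of_nonneg h8]; nlinarith
  · rw [abs_le]; constructor <;> nlinarith

/-- Columns vary by at most 1.58 L + 1, less than the factor ⌊2L⌋ + 2, so row and column can be
recovered from the number. -/
lemma cellId_eq_iff {L : ℝ} (hL : 510 ≤ L) {x y : Plane} (hx : x ∈ unitSquare)
    (hy : y ∈ unitSquare) : cellId L x = cellId L y ↔
      rowOf L (x 1) = rowOf L (y 1) ∧ colOf L (x 0) (x 1) = colOf L (y 0) (y 1) := by
  refine ⟨fun h => ?_, fun h => by rw [cellId, cellId, h.1, h.2]⟩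
  obtain ⟨h3, h4⟩ := colOf_mem hL (hx 0) (hx 1)
  obtain ⟨h3', h4'⟩ := colOf_mem hL (hy 0) (hy 1)
  have h6 := Int.lt_floor_add_one (2 * L)
  simp only [cellId] at h
  generalize rowOf L (x 1) = i at *
  generalize rowOf L (y 1) = i' at *
  generalize colOf L (x 0) (x 1) = j at *
  generalize colOf L (y 0) (y 1) = j' at *
  have hb1 : j - j' < ⌊2 * L⌋ + 2 := by
    have : (j : ℝ) - j' < (⌊2 * L⌋ : ℝ) + 2 := by linarith
    exact_mod_cast this
  have hb2 : j' - j < ⌊2 * L⌋ + 2 := by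
    have : (j' : ℝ) - j < (⌊2 * L⌋ : ℝ) + 2 := by linarith
    exact_mod_cast this
  generalize ⌊2 * L⌋ + 2 = B at *
  have hi : i = i' := by
    rcases lt_trichotomy i i' with hlt | heq | hgt
    · nlinarith
    · exact heq
    · nlinarith
  subst hi
  exact ⟨rfl, by linarith⟩

end Dispersion

namespace Dispersion

open RealRAM

/-! ## The program

Integer registers: `0` holds `n`, `1` holds `k`, `2` the index of the current point, `4` the number `1`,
`8` the factor in `cellId`, `10` the number of selected points; `5` and `6` hold the row and the column
of the current point, `7` its cell number. Real registers: `0` holds the scale, `3`, `4` and `5` hold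
`rowHeight`, `cellSide` and `1 / 2`. The cells of points that have been selected are marked by `1` in
the integer memory. -/

def setupCode : List Instr :=
  [.iconst 3 217, .toReal 0 3, .toReal 1 1, .rop .mul 0 0 1, .iconst 3 250, .toReal 1 3,
    .rop .div 0 0 1, .rsqrt 0 0, .iconst 3 8661, .toReal 3 3, .iconst 3 10000, .toReal 1 3,
    .rop .div 3 3 1, .iconst 4 1, .toReal 5 4, .iconst 3 230, .toReal 1 3, .rop .div 4 5 1,
    .iconst 3 2, .toReal 1 3, .rop .div 5 5 1, .rop .mul 1 1 0, .floor 8 1, .iop .add 8 8 3]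

def rowCode : List Instr :=
  [.iop .add 3 2 2, .rload 1 3, .iop .add 3 3 4, .rload 2 3, .rop .mul 1 1 0, .rop .mul 2 2 0,
    .rop .div 6 2 3, .floor 5 6, .toReal 6 5, .rop .mul 7 6 3, .rop .sub 7 2 7]

def colCode : List Instr :=
  [.rop .mul 6 6 5, .rop .sub 6 1 6, .floor 6 6, .toReal 7 6, .rop .sub 7 6 7]

def lookupCode : List Instr := [.iop .mul 7 5 8, .iop .add 7 7 6, .iload 9 7]

def emitCode : List Instr := [.emit 2, .istore 7 4, .iop .add 10 10 4]

def bodyProg : Prog :=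
  .seq
    (.seq (block rowCode)
      (.branch (.rlt 7 4)
        (.seq (block colCode)
          (.branch (.rlt 7 4)
            (.seq (block lookupCode)
              (.branch (.ilt 9 4) (.branch (.ilt 10 1) (block emitCode) .nop) .nop))
            .nop))
        .nop))
    (block [.iop .add 2 2 4])

def selectProg : Prog := .seq (block setupCode) (.loop (.ilt 2 0) bodyProg)

/-- The configuration in which the points `l` have been selected and the next point is number `t`. -/
structure Represents {n : ℕ} (L : ℝ) (k : ℕ) (p : Fin n → Plane) (t : ℕ) (l : List (Fin n))
    (s : State) : Prop where
  ireg_zero : s.ireg 0 = n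
  ireg_one : s.ireg 1 = k
  ireg_two : s.ireg 2 = t
  ireg_four : s.ireg 4 = 1
  ireg_eight : s.ireg 8 = ⌊2 * L⌋ + 2
  ireg_ten : s.ireg 10 = l.length
  rreg_zero : s.rreg 0 = L
  rreg_three : s.rreg 3 = rowHeight
  rreg_four : s.rreg 4 = cellSide
  rreg_five : s.rreg 5 = 2⁻¹
  rmem_eq : s.rmem = (input k p).rmem
  imem_eq : ∀ z, (s.imem z = 1 ∧ ∃ u ∈ l, cellId L (p u) = z) ∨
    (s.imem z = 0 ∧ ∀ u ∈ l, cellId L (p u) ≠ z)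
  out_eq : s.out = l.map fun i : Fin n => ((i : ℕ) : ℤ)

variable {n k W : ℕ} {p : Fin n → Plane}

lemma input_rmem_even (k : ℕ) (p : Fin n → Plane) {t : ℕ} (ht : t < n) :
    (input k p).rmem ((t : ℤ) + t) = p ⟨t, ht⟩ 0 := by
  have h : (0 : ℤ) ≤ (t : ℤ) + t ∧ (t : ℤ) + t < 2 * n := by omega
  have e : (((t : ℤ) + t) / 2).toNat = t := by omega
  have e' : ((t : ℤ) + t) % 2 = 0 := by omega
  simp only [input, dif_pos h, e, e', if_true]

lemma input_rmem_odd (k : ℕ) (p : Fin n → Plane) {t : ℕ} (ht : t < n) :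
    (input k p).rmem ((t : ℤ) + t + 1) = p ⟨t, ht⟩ 1 := by
  have h : (0 : ℤ) ≤ (t : ℤ) + t + 1 ∧ (t : ℤ) + t + 1 < 2 * n := by omega
  have e : (((t : ℤ) + t + 1) / 2).toNat = t := by omega
  have e' : ¬ ((t : ℤ) + t + 1) % 2 = 0 := by omega
  simp only [input, dif_pos h, e, if_neg e']

lemma runs_setupCode (hk : 3 * 10 ^ 5 ≤ k) (hkn : k ≤ n) (hW : 10000 + 10 * n ≤ W)
    (p : Fin n → Plane) :
    Runs W (block setupCode) (input k p) 25 (Represents (scale k) k p 0 []) := by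
  have hWz : (10000 : ℤ) + 10 * n ≤ W := by exact_mod_cast hW
  have hWr : (10000 : ℝ) + 10 * n ≤ W := by exact_mod_cast hW
  have hknr : (k : ℝ) ≤ n := by exact_mod_cast hkn
  have hL : 510 ≤ scale k := scale_ge hk
  have hL2 := scale_sq k
  have hLn : 2 * scale k + 2 ≤ W := by nlinarith
  have hfl0 : 0 ≤ ⌊2 * scale k⌋ := Int.floor_nonneg.2 (by linarith)
  have hfl : ⌊2 * scale k⌋ + 2 ≤ (W : ℤ) := by
    have : ((⌊2 * scale k⌋ : ℤ) : ℝ) + 2 ≤ W := by linarith [Int.floor_le (2 * scale k)]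
    exact_mod_cast this
  unfold setupCode
  refine .iconst (by norm_num; omega) ?_
  refine .toReal (v := 217) (by simp) ?_
  refine .toReal (v := k) (by simp [input]) ?_
  refine .rop (v := 217 * k) (by simp [RealOp.eval]) ?_
  refine .iconst (by norm_num; omega) ?_
  refine .toReal (v := 250) (by simp) ?_
  refine .rop (v := 217 * k / 250) (by simp [RealOp.eval]) ?_
  refine .rsqrt (v := scale k) (by simp; positivity) (by simp [scale]) ?_
  refine .iconst (by norm_num; omega) ?_
  refine .toReal (v := 8661) (by simp) ?_
  refine .iconst (by norm_num; omega) ?_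
  refine .toReal (v := 10000) (by simp) ?_
  refine .rop (v := rowHeight) (by simp [RealOp.eval, rowHeight]) ?_
  refine .iconst (by norm_num; omega) ?_
  refine .toReal (v := 1) (by simp) ?_
  refine .iconst (by norm_num; omega) ?_
  refine .toReal (v := 230) (by simp) ?_
  refine .rop (v := cellSide) (by simp [RealOp.eval, cellSide]) ?_
  refine .iconst (by norm_num; omega) ?_
  refine .toReal (v := 2) (by simp) ?_
  refine .rop (v := 1 / 2) (by simp [RealOp.eval]) ?_
  refine .rop (v := 2 * scale k) (by simp [RealOp.eval]) ?_
  refine .floor (v := ⌊2 * scale k⌋) (by simp) (by rw [abs_of_nonneg hfl0]; omega) ?_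
  refine .iop (v := ⌊2 * scale k⌋ + 2) (by simp [IntOp.eval])
    (by rw [abs_of_nonneg (by omega)]; omega) ?_
  refine .nop ?_
  constructor <;> simp [input]

lemma runs_bodyProg (hk : 3 * 10 ^ 5 ≤ k) (hkn : k ≤ n) (hW : 10000 + 10 * n ≤ W)
    (hp : ∀ i, p i ∈ unitSquare) {t : ℕ} (ht : t < n) {s : State} {l : List (Fin n)}
    (h : Represents (scale k) k p t l s) (hsel : IsSelection (scale k) k p t l) :
    Runs W bodyProg s 100 fun s' =>
      ∃ l', Represents (scale k) k p (t + 1) l' s' ∧ IsSelection (scale k) k p (t + 1) l' := by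
  have hWz : (10000 : ℤ) + 10 * n ≤ W := by exact_mod_cast hW
  have hWr : (10000 : ℝ) + 10 * n ≤ W := by exact_mod_cast hW
  have hknr : (k : ℝ) ≤ n := by exact_mod_cast hkn
  set L := scale k with hLdef
  have hL : 510 ≤ L := scale_ge hk
  have hL2 : L ^ 2 = 217 * k / 250 := scale_sq k
  set x := p ⟨t, ht⟩ with hx
  have hxs : x ∈ unitSquare := hp _
  -- 3 L² = 2.604 k is below the word bound because k ≤ n.
  have hb : ∀ z : ℤ, |(z : ℝ)| ≤ 3 * L ^ 2 → |z| ≤ (W : ℤ) := by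
    intro z hz
    have : |(z : ℝ)| ≤ W := by linarith
    exact_mod_cast this
  obtain ⟨hr1, hr2⟩ := rowOf_mem hL (hxs 1)
  have hr1' : (0 : ℝ) ≤ rowOf L (x 1) := by exact_mod_cast hr1
  obtain ⟨hc1, hc2⟩ := colOf_mem hL (hxs 0) (hxs 1)
  have hrow : |rowOf L (x 1)| ≤ (W : ℤ) := hb _ (by rw [abs_of_nonneg hr1']; nlinarith)
  have hcol : |colOf L (x 0) (x 1)| ≤ (W : ℤ) := hb _ (by rw [abs_le]; constructor <;> nlinarith)
  obtain ⟨hid1, hid2⟩ := cellId_bounds hL hxs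
  have hid1' := hb _ (by exact_mod_cast hid1)
  have hid2' := hb _ hid2
  have hη := rowHeight_pos.ne'
  refine Runs.mono (T := (12 + (1 + (6 + (1 + (4 + (1 + (1 + 4))))))) + 2)
    (Q := fun s' => ∃ l', Represents L k p (t + 1) l' s' ∧ IsSelection L k p (t + 1) l')
    ?_ (by norm_num) fun _ h => h
  unfold bodyProg
  refine Runs.seq (Runs.mono (T := 12 + (1 + (6 + (1 + (4 + (1 + (1 + 4)))))))
    (Q := fun s' => ∃ l', Represents L k p t l' s' ∧ IsSelection L k p (t + 1) l') ?_ le_rfl ?_)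
  swap
  · rintro s' ⟨l', h', hsel'⟩
    refine .iop (v := (t : ℤ) + 1) (by simp [IntOp.eval, h'.ireg_two, h'.ireg_four])
      (by rw [abs_of_nonneg (by omega)]; omega) (.nop ⟨l', ?_, hsel'⟩)
    obtain ⟨a0, a1, a2, a3, a4, a5, a6, a7, a8, a9, a10, a11, a12⟩ := h'
    exact ⟨by simpa, by simpa, by simp, by simpa, by simpa, by simpa, a6, a7, a8, a9, a10, a11, a12⟩
  -- Shared by the four branches that reject the point: two failed cell tests, a cell already
  -- marked, and a full selection.
  have hnop : ∀ (s' : State) (T : ℕ), 1 ≤ T → Represents L k p t l s' → (InCell L (x 0) (x 1) →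
      l.length = k ∨ ∃ v ∈ l, cellId L (p v) = cellId L x) → Runs W .nop s' T
      fun s' => ∃ l', Represents L k p t l' s' ∧ IsSelection L k p (t + 1) l' := by
    intro s' T hT h' hc
    exact Runs.mono (.nop ⟨l, h', hsel.skip ht hc⟩) hT fun _ h => h
  refine Runs.seq (Runs.mono (T := 12) (Q := fun s' => Represents L k p t l s' ∧
    s'.ireg 5 = rowOf L (x 1) ∧ s'.rreg 1 = x 0 * L ∧ s'.rreg 6 = rowOf L (x 1) ∧
    s'.rreg 7 = x 1 * L - rowOf L (x 1) * rowHeight) ?_ le_rfl ?_)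
  · obtain ⟨a0, a1, a2, a3, a4, a5, a6, a7, a8, a9, a10, a11, a12⟩ := h
    unfold rowCode
    refine .iop (v := (t : ℤ) + t) (by simp [IntOp.eval, a2])
      (by rw [abs_of_nonneg (by omega)]; omega) ?_
    refine .rload (v := x 0) (by simp [a10, input_rmem_even k p ht, hx]) ?_
    refine .iop (v := (t : ℤ) + t + 1) (by simp [IntOp.eval, a3])
      (by rw [abs_of_nonneg (by omega)]; omega) ?_
    refine .rload (v := x 1) (by simp [a10, input_rmem_odd k p ht, hx]) ?_
    refine .rop (v := x 0 * L) (by simp [RealOp.eval, a6]) ?_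
    refine .rop (v := x 1 * L) (by simp [RealOp.eval, a6]) ?_
    refine .rop (v := x 1 * L / rowHeight) (by simp [RealOp.eval, a7, hη]) ?_
    refine .floor (v := rowOf L (x 1)) (by simp [rowOf]) hrow ?_
    refine .toReal (v := rowOf L (x 1)) (by simp) ?_
    refine .rop (v := rowOf L (x 1) * rowHeight) (by simp [RealOp.eval, a7]) ?_
    refine .rop (v := x 1 * L - rowOf L (x 1) * rowHeight) (by simp [RealOp.eval]) ?_
    refine .nop ⟨?_, by simp, by simp, by simp, by simp⟩
    constructor <;> simpa
  clear h s
  rintro s ⟨h, b5, b1, b6, b7⟩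
  refine .branch ?_ fun hn => hnop s _ (by norm_num) h fun hc => absurd ?_ hn
  swap
  · change s.rreg 7 < s.rreg 4
    rw [b7, h.rreg_four]; exact hc.1
  intro hrowc
  change s.rreg 7 < s.rreg 4 at hrowc
  rw [b7, h.rreg_four] at hrowc
  refine Runs.seq (Runs.mono (T := 6) (Q := fun s' => Represents L k p t l s' ∧
    s'.ireg 5 = rowOf L (x 1) ∧ s'.ireg 6 = colOf L (x 0) (x 1) ∧
    s'.rreg 7 = x 0 * L - rowOf L (x 1) * (1 / 2) - colOf L (x 0) (x 1)) ?_ le_rfl ?_)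
  · obtain ⟨a0, a1, a2, a3, a4, a5, a6, a7, a8, a9, a10, a11, a12⟩ := h
    unfold colCode
    refine .rop (v := rowOf L (x 1) * (1 / 2)) (by simp [RealOp.eval, a9, b6]) ?_
    refine .rop (v := x 0 * L - rowOf L (x 1) * (1 / 2)) (by simp [RealOp.eval, b1]) ?_
    refine .floor (v := colOf L (x 0) (x 1)) (by simp [colOf]) hcol ?_
    refine .toReal (v := colOf L (x 0) (x 1)) (by simp) ?_
    refine .rop (v := x 0 * L - rowOf L (x 1) * (1 / 2) - colOf L (x 0) (x 1))
      (by simp [RealOp.eval]) ?_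
    refine .nop ⟨?_, by simpa, by simp, by simp⟩
    constructor <;> simpa
  clear h b5 b1 b6 b7 s
  rintro s ⟨h, b5, b6, b7⟩
  refine .branch ?_ fun hn => hnop s _ (by norm_num) h fun hc => absurd ?_ hn
  swap
  · change s.rreg 7 < s.rreg 4
    rw [b7, h.rreg_four]; exact hc.2
  intro hcolc
  change s.rreg 7 < s.rreg 4 at hcolc
  rw [b7, h.rreg_four] at hcolc
  have hin : InCell L (x 0) (x 1) := ⟨hrowc, hcolc⟩
  refine Runs.seq (Runs.mono (T := 4) (Q := fun s' => Represents L k p t l s' ∧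
    s'.ireg 7 = cellId L x ∧ s'.ireg 9 = s'.imem (cellId L x)) ?_ le_rfl ?_)
  · obtain ⟨a0, a1, a2, a3, a4, a5, a6, a7, a8, a9, a10, a11, a12⟩ := h
    unfold lookupCode
    refine .iop (v := rowOf L (x 1) * (⌊2 * L⌋ + 2)) (by simp [IntOp.eval, b5, a4]) hid1' ?_
    refine .iop (v := cellId L x) (by simp [IntOp.eval, b6, cellId]) hid2' ?_
    refine .iload (v := s.imem (cellId L x)) (by simp) ?_ ?_
    · rcases a11 (cellId L x) with ⟨e, -⟩ | ⟨e, -⟩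
      · rw [e, abs_one]; omega
      · rw [e, abs_zero]; omega
    refine .nop ⟨?_, by simp, by simp⟩
    constructor <;> simpa
  clear h b5 b6 b7 s
  rintro s ⟨h, b7, b9⟩
  refine .branch ?_ fun hn => hnop s _ (by norm_num) h fun _ => .inr ?_
  swap
  · rcases h.imem_eq (cellId L x) with ⟨-, e⟩ | ⟨e, -⟩
    · exact e
    · refine absurd ?_ hn
      change s.ireg 9 < s.ireg 4
      rw [b9, e, h.ireg_four]; norm_num
  intro hmark
  change s.ireg 9 < s.ireg 4 at hmark
  have hnew : ∀ v ∈ l, cellId L (p v) ≠ cellId L x := by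
    rcases h.imem_eq (cellId L x) with ⟨e, -⟩ | ⟨-, e⟩
    · rw [b9, e, h.ireg_four] at hmark; omega
    · exact e
  refine .branch ?_ fun hn => hnop s _ (by norm_num) h fun _ => .inl ?_
  swap
  · by_contra hne
    refine hn ?_
    change s.ireg 10 < s.ireg 1
    rw [h.ireg_ten, h.ireg_one]
    exact_mod_cast lt_of_le_of_ne hsel.length_le hne
  intro hlen
  change s.ireg 10 < s.ireg 1 at hlen
  rw [h.ireg_ten, h.ireg_one] at hlen
  have hlen' : l.length < k := by exact_mod_cast hlen
  obtain ⟨a0, a1, a2, a3, a4, a5, a6, a7, a8, a9, a10, a11, a12⟩ := h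
  unfold emitCode
  refine .cons rfl (.cons rfl (.iop (v := (l.length : ℤ) + 1) (by simp [IntOp.eval, a5, a3])
    (by rw [abs_of_nonneg (by omega)]; omega) ?_))
  refine .nop ⟨l ++ [⟨t, ht⟩], ?_, hsel.append ht hin hlen' hnew⟩
  refine ⟨by simpa, by simpa, by simpa, by simpa, by simpa, by simp, a6, a7, a8, a9, a10, ?_, ?_⟩
  · intro z
    simp only [State.withInt_imem, b7, a3, Function.update_apply]
    by_cases hz : z = cellId L x
    · subst hz
      exact .inl ⟨by simp, ⟨t, ht⟩, by simp, rfl⟩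
    · rw [if_neg hz]
      rcases a11 z with ⟨e, u, hu, huz⟩ | ⟨e, hu⟩
      · exact .inl ⟨e, u, List.mem_append_left _ hu, huz⟩
      · refine .inr ⟨e, fun u hu' => ?_⟩
        rcases List.mem_append.1 hu' with hu' | hu'
        · exact hu u hu'
        · rw [List.mem_singleton.1 hu']; exact fun e => hz e.symm
  · simp [a12, a2]

/-- The program halts in linear time with a selection from all points. -/
lemma runs_selectProg (hk : 3 * 10 ^ 5 ≤ k) (hkn : k ≤ n) (hp : ∀ i, p i ∈ unitSquare) :
    ∃ l : List (Fin n), OutputsWithin selectProg (1000 * n) (1000 * n) k p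
      (l.map fun i : Fin n => ((i : ℕ) : ℤ)) ∧ IsSelection (scale k) k p n l := by
  -- The program constants fit into words because n ≥ k ≥ 3 · 10⁵.
  have hW : 10000 + 10 * n ≤ 1000 * n := by omega
  have hrun : Runs (1000 * n) selectProg (input k p) (25 + ((100 + 1) * (n - 0) + 1))
      fun s => ∃ l, Represents (scale k) k p n l s ∧ IsSelection (scale k) k p n l := by
    refine Runs.seq ((runs_setupCode hk hkn hW p).mono le_rfl fun s hs => ?_)
    refine Runs.loop (I := fun m s => ∃ l, Represents (scale k) k p m l s ∧
      IsSelection (scale k) k p m l) ?_ ?_ (Nat.zero_le n) ⟨[], hs, .nil⟩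
    · rintro m s ⟨l, h, hsel⟩ hm
      refine ⟨?_, runs_bodyProg hk hkn hW hp hm h hsel⟩
      change s.ireg 2 < s.ireg 0
      rw [h.ireg_two, h.ireg_zero]; exact_mod_cast hm
    · rintro s ⟨l, h, -⟩ hlt
      change s.ireg 2 < s.ireg 0 at hlt
      rw [h.ireg_two, h.ireg_zero] at hlt
      exact lt_irrefl _ hlt
  obtain ⟨T, s, hT, he, l, h, hsel⟩ := hrun
  exact ⟨l, ⟨T, s, by omega, he, h.out_eq⟩, hsel⟩

/-! ## The quality of the selection -/

lemma dist_plane_sq (x y : Plane) : dist x y ^ 2 = (x 0 - y 0) ^ 2 + (x 1 - y 1) ^ 2 := by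
  rw [EuclideanSpace.dist_eq, Real.sq_sqrt (by positivity), Fin.sum_univ_two, Real.dist_eq,
    Real.dist_eq, sq_abs, sq_abs]

lemma minDist_le {n : ℕ} (p : Fin n → Plane) {K : Finset (Fin n)} {i j : Fin n} (hi : i ∈ K)
    (hj : j ∈ K) (hij : i ≠ j) : minDist p K ≤ dist (p i) (p j) :=
  csInf_le ⟨0, by rintro _ ⟨_, _, _, _, _, rfl⟩; exact dist_nonneg⟩ ⟨i, hi, j, hj, hij, rfl⟩

lemma minDist_nonneg {n : ℕ} (p : Fin n → Plane) (K : Finset (Fin n)) : 0 ≤ minDist p K :=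
  Real.sInf_nonneg (by rintro _ ⟨_, _, _, _, _, rfl⟩; exact dist_nonneg)

lemma opt_le (hk : 3 * 10 ^ 5 ≤ k) (hkn : k ≤ n) (hp : ∀ i, p i ∈ unitSquare) :
    0.99 * opt p k ≤ 19877 / 20000 / scale k := by
  have key : opt p k ≤ 19877 / 20000 / scale k / 0.99 := by
    refine csSup_le ?_ ?_
    · obtain ⟨K, -, hK⟩ := Finset.exists_subset_card_eq (s := (Finset.univ : Finset (Fin n)))
        (n := k) (by simpa using hkn)
      exact ⟨_, K, hK, rfl⟩
    · rintro _ ⟨K, hK, rfl⟩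
      have h0 := minDist_nonneg p K
      have h1 := separation_mul_le_one K (fun i => (p i 0, p i 1)) h0
        (fun i _ => ⟨hp i 0, hp i 1⟩) fun i hi j hj hij => by
          rw [← dist_plane_sq]
          exact pow_le_pow_left₀ h0 (minDist_le p hi hj hij) 2
      rw [hK] at h1
      have := scaled_opt_le hk h0 h1
      rw [le_div_iff₀ (by norm_num)]
      linarith
  rw [le_div_iff₀ (by norm_num)] at key
  linarith

lemma IsSelection.minDist_ge (hk : 3 * 10 ^ 5 ≤ k) {t : ℕ} {l : List (Fin n)}
    (h : IsSelection (scale k) k p t l) (hlen : l.length = k) :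
    19877 / 20000 / scale k ≤ minDist p l.toFinset := by
  have hL : 0 < scale k := lt_of_lt_of_le (by norm_num) (scale_ge hk)
  refine le_csInf ?_ ?_
  -- A pair must exist, as the infimum of the empty set would be 0.
  · obtain ⟨i, hi, j, hj, hij⟩ := Finset.one_lt_card.1
      (show 1 < l.toFinset.card by rw [List.toFinset_card_of_nodup h.nodup]; omega)
    exact ⟨_, i, hi, j, hj, hij, rfl⟩
  · rintro _ ⟨i, hi, j, hj, hij, rfl⟩
    rw [List.mem_toFinset] at hi hj
    have hne : rowOf (scale k) (p i 1) ≠ rowOf (scale k) (p j 1) ∨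
        colOf (scale k) (p i 0) (p i 1) ≠ colOf (scale k) (p j 0) (p j 1) := by
      by_contra hcon
      push Not at hcon
      exact hij (h.inj i hi j hj (by rw [cellId, cellId, hcon.1, hcon.2]))
    have hd := sq_dist_ge_of_cell_ne (h.inCell i hi) (h.inCell j hj) hne
    rw [← dist_plane_sq, ← mul_pow] at hd
    rw [div_le_iff₀ hL, mul_comm]
    exact le_of_sq_le_sq hd (by positivity)

/-- A selection that is not full represents every cell that is hit, and k distinct cells are hit. -/
lemma IsSelection.length_eq (hk : 3 * 10 ^ 5 ≤ k) {l : List (Fin n)}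
    (h : IsSelection (scale k) k p n l) (hp : ∀ i, p i ∈ unitSquare) {S : Finset (ℤ × ℤ)}
    (hS : S.card = k) (hhit : ∀ c ∈ S, ∃ i, p i ∈ cell (scale k) c) : l.length = k := by
  have hL : 510 ≤ scale k := scale_ge hk
  by_contra hne
  have hsub : S ⊆ l.toFinset.image
      fun i => (rowOf (scale k) (p i 1), colOf (scale k) (p i 0) (p i 1)) := by
    intro c hc
    obtain ⟨i, hi⟩ := hhit c hc
    obtain ⟨h1, h2, h3⟩ := mem_cell (by linarith) hi
    rcases h.complete i i.2 h3 with hl | ⟨v, hv, hvi⟩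
    · exact absurd hl hne
    · obtain ⟨e1, e2⟩ := (cellId_eq_iff hL (hp v) (hp i)).1 hvi
      refine Finset.mem_image.2 ⟨v, List.mem_toFinset.2 hv, ?_⟩
      rw [e1, e2, h1, h2]
  have := (Finset.card_le_card hsub).trans (Finset.card_image_le.trans l.toFinset_card_le)
  exact hne (le_antisymm h.length_le (hS ▸ this))

end Dispersion

/-! ### Running time, probability and quality combined. -/

theorem theorem4 :
    ∃ (prog : RealRAM.Prog) (C N : ℕ), ∀ n : ℕ, N ≤ n → ∀ k : ℕ, 3 * 10 ^ 5 ≤ k →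
      (k : ℝ) ≤ (n : ℝ) / (10 ^ 5 * Real.log (n : ℝ)) →
      (∀ p : Fin n → Dispersion.Plane, (∀ i, p i ∈ Dispersion.unitSquare) →
        ∃ out : List ℤ, Dispersion.OutputsWithin prog (C * n) (C * n) k p out) ∧
      (∃ E : Set (Fin n → Dispersion.Plane), MeasurableSet E ∧
        ENNReal.ofReal (1 - 1 / (n : ℝ)) ≤ Dispersion.uniformPoints n E ∧
        ∀ p ∈ E, ∃ out : List ℤ, Dispersion.OutputsWithin prog (C * n) (C * n) k p out ∧
          Dispersion.IsApprox 0.99 p k out) := by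
  refine ⟨Dispersion.selectProg, 1000, 3, fun n hn k hk hkn => ?_⟩
  have hn' : (3 : ℝ) ≤ n := by exact_mod_cast hn
  have hlog : 1 ≤ Real.log n := by
    rw [Real.le_log_iff_exp_le (by linarith)]
    linarith [Real.exp_one_lt_d9]
  have hkn' : k ≤ n := by
    rw [le_div_iff₀ (by positivity)] at hkn
    have : (k : ℝ) ≤ n := by nlinarith [(Nat.cast_nonneg k : (0 : ℝ) ≤ k)]
    exact_mod_cast this
  refine ⟨fun p hp => ?_, ?_⟩
  · obtain ⟨l, hl, -⟩ := Dispersion.runs_selectProg hk hkn' hp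
    exact ⟨_, hl⟩
  · obtain ⟨S, hS, hSc⟩ := Dispersion.exists_cells hk
    obtain ⟨hE, hEp⟩ := Dispersion.uniformPoints_hit_cells_ge hn hk hkn hS hSc
    refine ⟨_, hE, hEp, fun p hp => ?_⟩
    obtain ⟨l, hl, hsel⟩ := Dispersion.runs_selectProg hk hkn' hp.1
    have hlen := hsel.length_eq hk hp.1 hS hp.2
    refine ⟨_, hl, l, ?_, hsel.nodup, hlen,
      (Dispersion.opt_le hk hkn' hp.1).trans (hsel.minDist_ge hk hlen)⟩
    simp only [List.pure_def, List.bind_eq_flatMap, List.map_flatMap, List.map_cons, List.map_nil]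
    exact List.map_eq_flatMap
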